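/- Let $Q_n$ be the $n$-dimensional hypercube, whose vertices are the binary strings of length $n$, two of them being adjacent if and only if they differ in exactly one digit. Let $FQ_n$ be the $n$-dimensional folded hypercube, obtained from $Q_n$ by adding an edge between any two complementary strings $x_1x_2\cdots x_n$ and $\overline{x_1}\,\overline{x_2}\cdots\overline{x_n}$, where $\overline{x_i}=1-x_i$. For a graph $G$ and a set $S\subseteq V(G)$, an $S$-tree is a subgraph $T$ of $G$ that is a tree with $S\subseteq V(T)$. The $S$-trees $T_1,\dots,T_r$ are internally disjoint if $E(T_i)\cap E(T_j)=\emptyset$ and $V(T_i)\cap V(T_j)=S$ for all $i\ne j$. Let $\kappa_G(S)$ be the maximum number of internally disjoint $S$-trees in $G$, and for $2\le k\le |V(G)|$ let the generalized $k$-connectivity of $G$ be $$\kappa_k(G)=\min\{\kappa_G(S) : S\subseteq V(G),\ |S|=k\}.$$ **Theorem.** For every integer $n\ge 2$, $\kappa_3(FQ_n)=n$. Equivalently, for every set $S$ of three vertices of $FQ_n$ there exist $n$ internally disjoint $S$-trees in $FQ_n$, and $n$ is the largest integer with this property. -/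

import Mathlib

/-- The `n`-dimensional hypercube: vertices are the binary strings of length `n`, and two of them
are adjacent iff they differ in exactly one digit. -/
def hypercube (n : ℕ) : SimpleGraph (Fin n → Bool) where
  Adj x y := ∃! i, x i ≠ y i
  symm := ⟨fun x y h => by simpa only [ne_comm] using h⟩
  loopless := ⟨fun x h => h.exists.elim fun _ hi => hi rfl⟩

/-- The `n`-dimensional folded hypercube: the hypercube together with an edge between any two
complementary binary strings. (`SimpleGraph.fromRel` only symmetrizes the relation and removes
loops; a loop could arise only for `n = 0`.) -/
def foldedHypercube (n : ℕ) : SimpleGraph (Fin n → Bool) :=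
  hypercube n ⊔ SimpleGraph.fromRel fun x y => ∀ i, y i = !(x i)

/-- An `S`-tree in `G`: a subgraph of `G` that is a tree and contains all vertices of `S`. -/
def IsSTree {V : Type*} (G : SimpleGraph V) (S : Finset V) (T : G.Subgraph) : Prop :=
  T.coe.IsTree ∧ (S : Set V) ⊆ T.verts

/-- There are `r` internally disjoint `S`-trees in `G`: they are pairwise edge-disjoint, and any
two of them have exactly the vertices of `S` in common. -/
def HasInternallyDisjointTrees {V : Type*} (G : SimpleGraph V) (S : Finset V) (r : ℕ) : Prop :=
  ∃ T : Fin r → G.Subgraph, (∀ i, IsSTree G S (T i)) ∧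
    ∀ i j, i ≠ j →
      (T i).edgeSet ∩ (T j).edgeSet = ∅ ∧ (T i).verts ∩ (T j).verts = (S : Set V)

/-- `κ_G(S)`: the maximum number of internally disjoint `S`-trees in `G` (as an extended natural
number, so that no junk value occurs if there is no maximum). -/
noncomputable def treeConnectivity {V : Type*} (G : SimpleGraph V) (S : Finset V) : ℕ∞ :=
  ⨆ (r : ℕ) (_ : HasInternallyDisjointTrees G S r), (r : ℕ∞)

/-- The generalized `k`-connectivity `κ_k(G)`: the minimum of `κ_G(S)` over all sets `S` of `k`
vertices of `G`. -/
noncomputable def generalizedConnectivity {V : Type*} (G : SimpleGraph V) (k : ℕ) : ℕ∞ :=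
  ⨅ (S : Finset V) (_ : S.card = k), treeConnectivity G S

/-!
The folded hypercube is a Cayley graph of `(ℤ/2)ⁿ` with `n + 1` generators whose only relation is
that their sum vanishes. Hence its vertices can be named by the sets of generators, two sets naming
the same vertex iff they are equal or complementary (`IsFoldedNaming`), and edges change the
membership of one generator. Names may be translated by any set.

**Upper bound.** `n + 1` trees through two adjacent vertices `x`, `y` of degree `n + 1` would use
exactly one edge each at `x` and at `y`, so the tree containing the edge `xy` would be just that
edge and miss the third terminal (`lt_of_hasInternallyDisjointTrees`).

**Lower bound.** It suffices to find `n` disjoint connected sets of vertices outside `S` to which all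
three terminals are adjacent (`hasInternallyDisjointTrees_of_sets`). After a translation by the
majority of the names, the terminals are named by three disjoint classes `P₁, P₂, P₃` of
generators; let `P₀` be the class of the remaining generators (`exists_colouring`). The
four classes play symmetric roles: labelling them by the elements of the Klein four-group,
translations of the names realize the translations of the labels (`part_translate`). Distinctness
of the terminals means that at most one class is empty.

A generator `i ∈ P_k` gives a tree that leaves all three terminals `P_t` by the generator `i`, and
then follows from each of them the generators of the class `P_{k + t}`; the three branches meet in
one vertex. Two such trees with indices `i`, `j` in different classes of size at least two meet
only if both branches towards one terminal contain the vertex obtained from it by `i` and `j`,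
which is avoided by choosing the first generator of each branch well (`exists_choice`). If no more
than one class has a single element, the trees with indices in the larger classes are therefore
at least `n` in number (`hasTrees_of_parts`); a class of two elements needs some care if another
class is empty (`Allowed`).

If two classes are singletons `{p}` and `{q}`, they may be taken to name two of the terminals, and
the third terminal is named by a set `B` not containing `p` and `q`; translation by `{p, q}` replaces
`B` by the complement of `B ∪ {p, q}`. Explicit trees exist if `B` is empty (`hasTrees_path`), if it
is a singleton (`hasTrees_singleton`), and if `B` and this complement have at least two elements
(`hasTrees_of_two_le`).
-/

open scoped symmDiff

/-! ### Trees from disjoint connected sets -/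

/-- `ReachableWithin G W a b`: some walk in `G` leads from `a` to `b` inside the vertex set `W`. -/
def ReachableWithin {V : Type*} (G : SimpleGraph V) (W : Set V) : V → V → Prop :=
  Relation.ReflTransGen fun a b => a ∈ W ∧ b ∈ W ∧ G.Adj a b

theorem ReachableWithin.single {V : Type*} {G : SimpleGraph V} {W : Set V} {a b : V}
    (ha : a ∈ W) (hb : b ∈ W) (h : G.Adj a b) : ReachableWithin G W a b :=
  Relation.ReflTransGen.single ⟨ha, hb, h⟩

theorem ReachableWithin.trans {V : Type*} {G : SimpleGraph V} {W : Set V} {a b c : V}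
    (hab : ReachableWithin G W a b) (hbc : ReachableWithin G W b c) : ReachableWithin G W a c :=
  Relation.ReflTransGen.trans hab hbc

/-- A connected subgraph has a spanning tree, viewed again as a subgraph of the ambient graph. -/
theorem exists_spanning_tree_subgraph {V : Type*} {G : SimpleGraph V} (H : G.Subgraph)
    (hH : H.coe.Connected) : ∃ T : G.Subgraph, T.coe.IsTree ∧ T ≤ H ∧ T.verts = H.verts := by
  obtain ⟨T, hT, htree⟩ := hH.exists_isTree_le
  let T' : G.Subgraph :=
    { verts := H.verts
      Adj := fun a b => ∃ (ha : a ∈ H.verts) (hb : b ∈ H.verts), T.Adj ⟨a, ha⟩ ⟨b, hb⟩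
      adj_sub := fun ⟨_, _, h⟩ => H.adj_sub (hT h)
      edge_vert := fun ⟨ha, _, _⟩ => ha
      symm := ⟨fun _ _ ⟨ha, hb, h⟩ => ⟨hb, ha, h.symm⟩⟩ }
  refine ⟨T', ?_, ⟨le_rfl, fun a b ⟨_, _, h⟩ => hT h⟩, rfl⟩
  have : T'.coe = T := by
    ext a b
    exact ⟨fun ⟨_, _, h⟩ => h, fun h => ⟨a.2, b.2, h⟩⟩
  rw [this]
  exact htree

/-- Connected subgraphs suffice in place of trees, since they can be replaced by spanning trees. -/
theorem hasInternallyDisjointTrees_of_connected {V J : Type*} [Finite J] {G : SimpleGraph V}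
    {S : Finset V} {r : ℕ} (hr : r ≤ Nat.card J) (H : J → G.Subgraph)
    (hconn : ∀ j, (H j).coe.Connected) (hS : ∀ j, (S : Set V) ⊆ (H j).verts)
    (hedge : ∀ i j, i ≠ j → ∀ a b, (H i).Adj a b → ¬ (H j).Adj a b)
    (hvert : ∀ i j, i ≠ j → (H i).verts ∩ (H j).verts ⊆ S) :
    HasInternallyDisjointTrees G S r := by
  choose T hT hle hv using fun j => exists_spanning_tree_subgraph (H j) (hconn j)
  -- any `r` of the `Nat.card J` trees will do
  let e : Fin r → J := fun i => (Finite.equivFin J).symm (Fin.castLE hr i)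
  have he : Function.Injective e :=
    (Finite.equivFin J).symm.injective.comp (Fin.castLE_injective hr)
  refine ⟨fun i => T (e i), fun i => ⟨hT _, by rw [hv]; exact hS _⟩, fun i j hij => ⟨?_, ?_⟩⟩
  · ext x
    induction x with
    | _ a b =>
      simp only [Set.mem_inter_iff, SimpleGraph.Subgraph.mem_edgeSet, Set.mem_empty_iff_false,
        iff_false, not_and]
      exact fun h1 h2 => hedge _ _ (he.ne hij) a b ((hle _).2 h1) ((hle _).2 h2)
  · rw [hv, hv]
    exact (hvert _ _ (he.ne hij)).antisymm (Set.subset_inter (hS _) (hS _))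

/-- The subgraph on `W ∪ S` containing all edges of `G` between vertices of `W ∪ S` except those
that join two vertices outside `W`. -/
def attachSubgraph {V : Type*} (G : SimpleGraph V) (S W : Set V) : G.Subgraph where
  verts := W ∪ S
  Adj a b := G.Adj a b ∧ a ∈ W ∪ S ∧ b ∈ W ∪ S ∧ (a ∈ W ∨ b ∈ W)
  adj_sub h := h.1
  edge_vert h := h.2.1
  symm := ⟨fun _ _ h => ⟨h.1.symm, h.2.2.1, h.2.1, h.2.2.2.symm⟩⟩

theorem attachSubgraph_connected {V : Type*} {G : SimpleGraph V} {S W : Set V} {c : V}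
    (hc : c ∈ W) (hW : ∀ w ∈ W, ReachableWithin G W w c) (hS : ∀ s ∈ S, ∃ w ∈ W, G.Adj s w) :
    (attachSubgraph G S W).coe.Connected := by
  have hreach : ∀ a, ReachableWithin G W a c → ∀ ha : a ∈ W ∪ S,
      (attachSubgraph G S W).coe.Reachable ⟨a, ha⟩ ⟨c, Or.inl hc⟩ := by
    intro a h
    induction h using Relation.ReflTransGen.head_induction_on with
    | refl => exact fun _ => SimpleGraph.Reachable.refl _
    | head h1 _ ih =>
      intro ha
      refine SimpleGraph.Reachable.trans (SimpleGraph.Adj.reachable ?_) (ih (Or.inl h1.2.1))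
      exact ⟨h1.2.2, ha, Or.inl h1.2.1, Or.inl h1.1⟩
  refine (SimpleGraph.connected_iff_exists_forall_reachable _).2 ⟨⟨c, Or.inl hc⟩, ?_⟩
  rintro ⟨a, ha | ha⟩
  · exact (hreach a (hW a ha) _).symm
  · obtain ⟨w, hw, hadj⟩ := hS a ha
    refine ((SimpleGraph.Adj.reachable ?_).trans (hreach w (hW w hw) (Or.inl hw))).symm
    exact ⟨hadj, Or.inr ha, Or.inl hw, Or.inr hw⟩

/-- Pairwise disjoint connected vertex sets that avoid `S` and to which all vertices of `S` are
adjacent give internally disjoint `S`-trees. -/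
theorem hasInternallyDisjointTrees_of_sets {V J : Type*} [Finite J] {G : SimpleGraph V}
    {S : Finset V} {r : ℕ} (hr : r ≤ Nat.card J) (W : J → Set V)
    (hconn : ∀ j, ∃ c ∈ W j, ∀ w ∈ W j, ReachableWithin G (W j) w c)
    (hSW : ∀ j, ∀ w ∈ W j, w ∉ S) (hdisj : ∀ i j, i ≠ j → ∀ w ∈ W i, w ∉ W j)
    (hadj : ∀ j, ∀ s ∈ S, ∃ w ∈ W j, G.Adj s w) : HasInternallyDisjointTrees G S r := by
  refine hasInternallyDisjointTrees_of_connected hr (fun j => attachSubgraph G S (W j))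
    (fun j => ?_) (fun j => Set.subset_union_right) (fun i j hij a b h1 h2 => ?_)
    (fun i j hij a h => ?_)
  · obtain ⟨c, hc, h⟩ := hconn j
    exact attachSubgraph_connected hc h (hadj j)
  · obtain ⟨-, ha, hb, h | h⟩ := h1
    · exact h2.2.1.elim (hdisj i j hij a h) (hSW i a h)
    · exact h2.2.2.1.elim (hdisj i j hij b h) (hSW i b h)
  · obtain ⟨h1 | h1, h2 | h2⟩ := h
    exacts [(hdisj i j hij a h1 h2).elim, h2, h1, h1]

/-- If moreover one vertex of `S` is adjacent to the other two, the path formed by these three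
vertices is one additional tree. -/
theorem hasInternallyDisjointTrees_of_sets_of_adj {V J : Type*} [Finite J] [DecidableEq V]
    {G : SimpleGraph V} {x y z : V} {r : ℕ} (hr : r ≤ Nat.card J + 1) (hx : G.Adj z x)
    (hy : G.Adj z y) (W : J → Set V)
    (hconn : ∀ j, ∃ c ∈ W j, ∀ w ∈ W j, ReachableWithin G (W j) w c)
    (hSW : ∀ j, ∀ w ∈ W j, w ∉ ({x, y, z} : Finset V))
    (hdisj : ∀ i j, i ≠ j → ∀ w ∈ W i, w ∉ W j)
    (hadj : ∀ j, ∀ s ∈ ({x, y, z} : Finset V), ∃ w ∈ W j, G.Adj s w) :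
    HasInternallyDisjointTrees G {x, y, z} r := by
  set S : Finset V := {x, y, z} with hSdef
  let P : G.Subgraph := attachSubgraph G S {z}
  have hzS : z ∈ S := by simp [hSdef]
  have hPv : P.verts = S := by
    change {z} ∪ (S : Set V) = S
    simpa using hzS
  let H : Option J → G.Subgraph := fun o => o.elim P fun j => attachSubgraph G S (W j)
  have key : ∀ j a b, (H (some j)).Adj a b → ¬ P.Adj a b := by
    rintro j a b ⟨-, ha, hb, h⟩ h2
    have ha' : a ∈ (S : Set V) := hPv ▸ P.edge_vert h2
    have hb' : b ∈ (S : Set V) := hPv ▸ P.edge_vert h2.symm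
    exact h.elim (fun h => hSW j a h ha') (fun h => hSW j b h hb')
  refine hasInternallyDisjointTrees_of_connected (J := Option J) (by simpa using hr) H ?_ ?_ ?_ ?_
  · rintro (_ | j)
    · -- the path on `S` itself
      refine (SimpleGraph.connected_iff_exists_forall_reachable _).2 ⟨⟨z, Or.inl rfl⟩, ?_⟩
      rintro ⟨a, ha⟩
      have ha' : a = x ∨ a = y ∨ a = z := by
        have : a ∈ (S : Set V) := hPv ▸ ha
        simpa [hSdef] using this
      have hadj' : ∀ b (hb : b ∈ P.verts), G.Adj z b →
          P.coe.Reachable ⟨z, Or.inl rfl⟩ ⟨b, hb⟩ := fun b hb h =>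
        SimpleGraph.Adj.reachable ⟨h, Or.inl rfl, hb, Or.inl rfl⟩
      rcases ha' with rfl | rfl | rfl
      exacts [hadj' _ _ hx, hadj' _ _ hy, SimpleGraph.Reachable.refl _]
    · obtain ⟨c, hc, h⟩ := hconn j
      exact attachSubgraph_connected hc h (hadj j)
  · rintro (_ | j)
    exacts [hPv.ge, Set.subset_union_right]
  · rintro (_ | i) (_ | j) hij a b h1 h2
    · exact hij rfl
    · exact key j a b h2 h1
    · exact key i a b h1 h2
    · have hij' : i ≠ j := fun h => hij (h ▸ rfl)
      obtain ⟨-, ha, hb, h | h⟩ := h1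
      · exact h2.2.1.elim (hdisj i j hij' a h) (hSW i a h)
      · exact h2.2.2.1.elim (hdisj i j hij' b h) (hSW i b h)
  · rintro (_ | i) (_ | j) hij a h
    · exact (hij rfl).elim
    · exact hPv ▸ h.1
    · exact hPv ▸ h.2
    · have hij' : i ≠ j := fun h => hij (h ▸ rfl)
      obtain ⟨h1 | h1, h2 | h2⟩ := h
      exacts [(hdisj i j hij' a h1 h2).elim, h2, h1, h1]

/-! ### The upper bound -/

/-- In a tree through two different terminals, each of them has a neighbour. -/
theorem IsSTree.exists_adj {V : Type*} {G : SimpleGraph V} {S : Finset V} {T : G.Subgraph}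
    (hT : IsSTree G S T) {x y : V} (hx : x ∈ S) (hy : y ∈ S) (hxy : x ≠ y) : ∃ w, T.Adj x w := by
  have : Nontrivial T.verts := ⟨⟨x, hT.2 hx⟩, ⟨y, hT.2 hy⟩, fun h => hxy (congrArg Subtype.val h)⟩
  obtain ⟨w, hw⟩ := SimpleGraph.Preconnected.exists_adj_of_nontrivial hT.1.1.preconnected
    ⟨x, hT.2 hx⟩
  exact ⟨w, hw⟩

/-- If `x` and `y` are adjacent vertices of degree at most `d`, fewer than `d` internally disjoint
trees join them to a third vertex `z`: each tree uses an edge at `x` and an edge at `y`, so `d`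
trees would use exactly one each, and the one using the edge `xy` could not reach `z`. -/
theorem lt_of_hasInternallyDisjointTrees {V : Type*} [DecidableEq V] {G : SimpleGraph V}
    {x y z : V} {d r : ℕ} (hxy : G.Adj x y) (hzx : z ≠ x) (hzy : z ≠ y)
    (hfx : (G.neighborSet x).Finite) (hfy : (G.neighborSet y).Finite)
    (hdx : (G.neighborSet x).ncard ≤ d) (hdy : (G.neighborSet y).ncard ≤ d)
    (h : HasInternallyDisjointTrees G {x, y, z} r) : r < d := by
  by_contra! hr
  obtain ⟨T, hT, hdisj⟩ := h
  have hedge : ∀ i j a b, (T i).Adj a b → (T j).Adj a b → i = j := by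
    intro i j a b h1 h2
    by_contra hij
    have := (hdisj i j hij).1
    exact (Set.ext_iff.1 this s(a, b)).1 ⟨h1, h2⟩
  -- the trees correspond bijectively to the edges at `u`, each of which is the only edge at `u` of
  -- its tree
  have main : ∀ u v, u ≠ v → u ∈ ({x, y, z} : Finset V) → v ∈ ({x, y, z} : Finset V) →
      (G.neighborSet u).Finite → (G.neighborSet u).ncard ≤ d →
      ∀ w, G.Adj u w → ∃ i, (T i).Adj u w ∧ ∀ w', (T i).Adj u w' → w' = w := by
    intro u v huv hu hv hfin hcard
    choose a ha using fun i => (hT i).exists_adj hu hv huv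
    let f : Fin r → G.neighborSet u := fun i => ⟨a i, (T i).adj_sub (ha i)⟩
    have hf : Function.Injective f := fun i j hij => by
      have hij' : a i = a j := congrArg Subtype.val hij
      exact hedge i j u (a i) (ha i) (hij' ▸ ha j)
    have : Finite (G.neighborSet u) := hfin
    have hsurj : Function.Surjective f := by
      refine (hf.bijective_of_nat_card_le ?_).2
      rw [Nat.card_coe_set_eq, Nat.card_eq_fintype_card, Fintype.card_fin]
      exact hcard.trans hr
    have hnbr : ∀ w, G.Adj u w → ∃ i, a i = w := fun w hw => by
      obtain ⟨i, hi⟩ := hsurj ⟨w, hw⟩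
      exact ⟨i, congrArg Subtype.val hi⟩
    intro w hw
    obtain ⟨i, rfl⟩ := hnbr w hw
    refine ⟨i, ha i, fun w' hw' => ?_⟩
    obtain ⟨j, rfl⟩ := hnbr w' ((T i).adj_sub hw')
    rw [hedge i j u _ hw' (ha j)]
  obtain ⟨i, hi, hi'⟩ := main x y hxy.ne (by simp) (by simp) hfx hdx y hxy
  obtain ⟨j, hj, hj'⟩ := main y x hxy.ne' (by simp) (by simp) hfy hdy x hxy.symm
  obtain rfl : i = j := hedge i j x y hi hj.symm
  have hclosed : ∀ b : (T i).verts, (T i).coe.Reachable ⟨x, (T i).edge_vert hi⟩ b →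
      b.1 = x ∨ b.1 = y := by
    intro b hb
    rw [SimpleGraph.reachable_iff_reflTransGen] at hb
    induction hb with
    | refl => exact Or.inl rfl
    | tail _ h ih =>
      rcases ih with e | e
      · exact Or.inr (hi' _ (e ▸ h))
      · exact Or.inl (hj' _ (e ▸ h))
  have hz := hclosed ⟨z, (hT i).2 (by simp)⟩ ((hT i).1.1.preconnected _ _)
  exact hz.elim hzx hzy

/-! ### Names of vertices by sets of generators -/

/-- A naming of the vertices of `G` by the subsets of `ι`, in which exactly complementary sets name
the same vertex, and changing the membership of a single element of `ι` leads to a neighbour.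
For the folded hypercube `ι` has `n + 1` elements: the `n` digits and the complementation. -/
structure IsFoldedNaming {ι V : Type*} (G : SimpleGraph V) (φ : Set ι → V) : Prop where
  eq_iff : ∀ A B, φ A = φ B ↔ A = B ∨ A = Bᶜ
  adj : ∀ A i, G.Adj (φ A) (φ (A ∆ {i}))

namespace IsFoldedNaming

variable {ι V : Type*} {G : SimpleGraph V} {φ : Set ι → V}

theorem compl (h : IsFoldedNaming G φ) (A : Set ι) : φ Aᶜ = φ A :=
  (h.eq_iff _ _).2 (Or.inr rfl)

theorem adj_insert (h : IsFoldedNaming G φ) {A : Set ι} {i : ι} (hi : i ∉ A) :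
    G.Adj (φ A) (φ (insert i A)) := by
  convert h.adj A i using 2
  ext w
  simp only [Set.mem_insert_iff, Set.mem_symmDiff, Set.mem_singleton_iff]
  grind

/-- The new name of a vertex is its old name translated by `U`. -/
theorem translate (h : IsFoldedNaming G φ) (U : Set ι) :
    IsFoldedNaming G fun A => φ (A ∆ U) where
  eq_iff A B := by
    rw [h.eq_iff]
    simp only [Set.ext_iff, Set.mem_symmDiff, Set.mem_compl_iff]
    grind
  adj A i := by
    have := h.adj (A ∆ U) i
    rwa [symmDiff_right_comm] at this

theorem reachableWithin_symmDiff (h : IsFoldedNaming G φ) {W : Set V} (A D : Set ι)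
    (hD : D.Finite) (hW : ∀ X ⊆ D, φ (A ∆ X) ∈ W) : ReachableWithin G W (φ A) (φ (A ∆ D)) := by
  induction D, hD using Set.Finite.induction_on with
  | empty =>
    have : A ∆ (∅ : Set ι) = A := symmDiff_bot A
    rw [this]
    exact .refl
  | @insert i D hi _ ih =>
    have e : A ∆ insert i D = (A ∆ D) ∆ {i} := by
      ext w
      simp only [Set.mem_insert_iff, Set.mem_symmDiff, Set.mem_singleton_iff]
      grind
    refine (ih fun X hX => hW X (hX.trans (Set.subset_insert _ _))).tail
      ⟨hW _ (Set.subset_insert _ _), hW _ subset_rfl, ?_⟩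
    rw [e]
    exact h.adj _ _

/-- Two vertices are joined inside any vertex set that contains the subcube spanned by their
names. -/
theorem reachableWithin_of_subcube [Finite ι] (h : IsFoldedNaming G φ) {W : Set V} {A B : Set ι}
    (hW : ∀ X, A ∩ B ⊆ X → X ⊆ A ∪ B → φ X ∈ W) : ReachableWithin G W (φ A) (φ B) := by
  have := h.reachableWithin_symmDiff (W := W) A (A ∆ B) (Set.toFinite _) ?_
  · rwa [symmDiff_symmDiff_cancel_left] at this
  · intro X hX
    apply hW
    · intro w hw
      have := @hX w
      simp only [Set.mem_symmDiff, Set.mem_inter_iff] at *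
      grind
    · intro w hw
      have := @hX w
      simp only [Set.mem_symmDiff, Set.mem_union] at *
      grind

/-- A version of `hasInternallyDisjointTrees_of_sets` for sets of vertices given by names. -/
theorem hasInternallyDisjointTrees (h : IsFoldedNaming G φ) {J : Type*} [Finite J]
    {S : Finset V} {r : ℕ} (hr : r ≤ Nat.card J) (𝒲 : J → Set (Set ι))
    (hconn : ∀ j, ∃ c ∈ 𝒲 j, ∀ A ∈ 𝒲 j, ReachableWithin G (φ '' 𝒲 j) (φ A) (φ c))
    (hSW : ∀ j, ∀ A ∈ 𝒲 j, φ A ∉ S)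
    (hdisj : ∀ i j, i ≠ j → ∀ A ∈ 𝒲 i, ∀ B ∈ 𝒲 j, A ≠ B ∧ A ≠ Bᶜ)
    (hadj : ∀ j, ∀ s ∈ S, ∃ A ∈ 𝒲 j, G.Adj s (φ A)) : HasInternallyDisjointTrees G S r := by
  refine hasInternallyDisjointTrees_of_sets hr (fun j => φ '' 𝒲 j) ?_ ?_ ?_ ?_
  · intro j
    obtain ⟨c, hc, hr⟩ := hconn j
    exact ⟨φ c, ⟨c, hc, rfl⟩, by rintro _ ⟨A, hA, rfl⟩; exact hr A hA⟩
  · rintro j _ ⟨A, hA, rfl⟩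
    exact hSW j A hA
  · rintro i j hij _ ⟨A, hA, rfl⟩ ⟨B, hB, e⟩
    have := hdisj i j hij A hA B hB
    exact ((h.eq_iff _ _).1 e.symm).elim this.1 this.2
  · intro j s hs
    obtain ⟨A, hA, hsA⟩ := hadj j s hs
    exact ⟨φ A, ⟨A, hA, rfl⟩, hsA⟩

/-- A version of `hasInternallyDisjointTrees_of_sets_of_adj` for sets of vertices given by names. -/
theorem hasInternallyDisjointTrees_of_adj [DecidableEq V] (h : IsFoldedNaming G φ) {J : Type*}
    [Finite J] {x y z : V} {r : ℕ} (hr : r ≤ Nat.card J + 1) (hx : G.Adj z x)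
    (hy : G.Adj z y) (𝒲 : J → Set (Set ι))
    (hconn : ∀ j, ∃ c ∈ 𝒲 j, ∀ A ∈ 𝒲 j, ReachableWithin G (φ '' 𝒲 j) (φ A) (φ c))
    (hSW : ∀ j, ∀ A ∈ 𝒲 j, φ A ∉ ({x, y, z} : Finset V))
    (hdisj : ∀ i j, i ≠ j → ∀ A ∈ 𝒲 i, ∀ B ∈ 𝒲 j, A ≠ B ∧ A ≠ Bᶜ)
    (hadj : ∀ j, ∀ s ∈ ({x, y, z} : Finset V), ∃ A ∈ 𝒲 j, G.Adj s (φ A)) :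
    HasInternallyDisjointTrees G {x, y, z} r := by
  refine hasInternallyDisjointTrees_of_sets_of_adj hr hx hy (fun j => φ '' 𝒲 j) ?_ ?_ ?_ ?_
  · intro j
    obtain ⟨c, hc, hr⟩ := hconn j
    exact ⟨φ c, ⟨c, hc, rfl⟩, by rintro _ ⟨A, hA, rfl⟩; exact hr A hA⟩
  · rintro j _ ⟨A, hA, rfl⟩
    exact hSW j A hA
  · rintro i j hij _ ⟨A, hA, rfl⟩ ⟨B, hB, e⟩
    have := hdisj i j hij A hA B hB
    exact ((h.eq_iff _ _).1 e.symm).elim this.1 this.2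
  · intro j s hs
    obtain ⟨A, hA, hsA⟩ := hadj j s hs
    exact ⟨φ A, ⟨A, hA, rfl⟩, hsA⟩

theorem adj_insert_compl (h : IsFoldedNaming G φ) {A B : Set ι} {i : ι} (hi : i ∉ A)
    (hB : (insert i A)ᶜ = B) : G.Adj (φ A) (φ B) := by
  rw [← hB, h.compl]
  exact h.adj_insert hi
end IsFoldedNaming

/-! ### Names of the vertices of the folded hypercube -/

open Classical in
/-- The vertex of the folded hypercube named by a set `A` of generators: the string with ones at
the digits in `A`, complemented if `none ∈ A`. -/
noncomputable def cubeVertex {n : ℕ} (A : Set (Option (Fin n))) : Fin n → Bool :=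
  fun i => decide (some i ∈ A ↔ none ∉ A)

theorem foldedHypercube_adj_iff {n : ℕ} (hn : n ≠ 0) (x y : Fin n → Bool) :
    (foldedHypercube n).Adj x y ↔ (∃! i, x i ≠ y i) ∨ ∀ i, y i = !(x i) := by
  simp only [foldedHypercube, SimpleGraph.sup_adj, SimpleGraph.fromRel_adj, hypercube]
  refine or_congr_right ⟨fun ⟨_, h⟩ => h.elim id fun h i => by simp [h i], fun h => ⟨?_, Or.inl h⟩⟩
  rintro rfl
  have := h ⟨0, Nat.pos_of_ne_zero hn⟩
  simp at this

theorem isFoldedNaming_cubeVertex {n : ℕ} (hn : n ≠ 0) :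
    IsFoldedNaming (foldedHypercube n) (cubeVertex (n := n)) where
  eq_iff A B := by
    simp only [cubeVertex, funext_iff, Set.ext_iff, Set.mem_compl_iff, Option.forall,
      decide_eq_decide]
    by_cases hA : none ∈ A <;> by_cases hB : none ∈ B <;> simp [hA, hB]
    all_goals grind
  adj A i := by
    rw [foldedHypercube_adj_iff hn]
    cases i with
    | none =>
      right
      intro i
      simp only [cubeVertex]
      by_cases hA : none ∈ A <;> by_cases hi : some i ∈ A <;> simp [Set.mem_symmDiff, hA, hi]
    | some i =>
      left
      refine ⟨i, ?_, fun j hj => ?_⟩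
      · simp only [cubeVertex]
        by_cases hA : none ∈ A <;> by_cases hi : some i ∈ A <;> simp [Set.mem_symmDiff, hA, hi]
      · by_contra hji
        simp [cubeVertex, Set.mem_symmDiff, hji] at hj

theorem cubeVertex_image_some {n : ℕ} (v : Fin n → Bool) :
    cubeVertex {o | ∃ i, v i = true ∧ o = some i} = v := by
  ext i
  simp [cubeVertex]

theorem neighborSet_foldedHypercube_subset {n : ℕ} (hn : n ≠ 0) (x : Fin n → Bool) :
    ((foldedHypercube n).neighborSet x) ⊆
      Set.range fun o : Option (Fin n) => o.elim (fun i => !(x i))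
        fun j => Function.update x j (!(x j)) := by
  intro y hy
  rw [SimpleGraph.mem_neighborSet, foldedHypercube_adj_iff hn] at hy
  rcases hy with ⟨j, hj, huniq⟩ | h
  · refine ⟨some j, ?_⟩
    ext i
    by_cases hij : i = j
    · subst hij
      simp only [Option.elim, Function.update_self]
      cases hx : x i <;> cases hyi : y i <;> simp_all
    · have : x i = y i := by
        by_contra hne
        exact hij (huniq i hne)
      simp [Function.update_of_ne hij, this]
  · exact ⟨none, (funext h).symm⟩

theorem ncard_neighborSet_foldedHypercube_le {n : ℕ} (hn : n ≠ 0) (x : Fin n → Bool) :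
    ((foldedHypercube n).neighborSet x).ncard ≤ n + 1 := by
  refine (Set.ncard_le_ncard (neighborSet_foldedHypercube_subset hn x) (Set.toFinite _)).trans ?_
  rw [← Set.image_univ]
  refine (Set.ncard_image_le (Set.toFinite _)).trans ?_
  simp [Set.ncard_univ]

namespace IsFoldedNaming

variable {ι V : Type*} {G : SimpleGraph V} {φ : Set ι → V}

/-! ### Two generators that each separate one terminal from the other two -/

/-- The terminals are `∅` and two of its neighbours `{p}` and `{q}`. One tree is the path on the
three terminals; the others have the centres `{k}` with `k ≠ p, q`. Some of the vertices
`{p, k}` and `{q, k}` coincide if there are at most four generators. -/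
theorem hasTrees_path [Finite ι] [DecidableEq V] (h : IsFoldedNaming G φ) {p q : ι} (hpq : p ≠ q)
    {n : ℕ} (hι : Nat.card ι = n + 1) :
    HasInternallyDisjointTrees G {φ {p}, φ {q}, φ ∅} n := by
  classical
  have hp : G.Adj (φ ∅) (φ {p}) := by simpa using h.adj_insert (Set.notMem_empty p)
  have hq : G.Adj (φ ∅) (φ {q}) := by simpa using h.adj_insert (Set.notMem_empty q)
  have hJ : n ≤ Nat.card {k // k ∉ ({p, q} : Set ι)} + 1 := by
    have h1 := Set.ncard_add_ncard_compl ({p, q} : Set ι)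
    rw [Set.ncard_pair hpq, hι] at h1
    have h2 : Nat.card {k // k ∉ ({p, q} : Set ι)} = ({p, q} : Set ι)ᶜ.ncard := rfl
    omega
  -- more than four generators or none besides `p` and `q`, as opposed to exactly three or four
  by_cases h3 : ∀ k k', k ≠ p → k ≠ q → k' ≠ p → k' ≠ q → ∃ l, l ≠ p ∧ l ≠ q ∧ l ≠ k ∧ l ≠ k'
  · refine h.hasInternallyDisjointTrees_of_adj (J := {k // k ∉ ({p, q} : Set ι)}) hJ hp hq
      (fun k => {{k.1}, {p, k.1}, {q, k.1}}) ?_ ?_ ?_ ?_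
    · rintro ⟨k, hk⟩
      simp only [Set.mem_insert_iff, Set.mem_singleton_iff, not_or] at hk
      refine ⟨{k}, by simp, ?_⟩
      rintro A (rfl | rfl | rfl)
      · exact .refl
      · exact .single ⟨_, by simp, rfl⟩ ⟨_, by simp, rfl⟩ (h.adj_insert (by simp; grind)).symm
      · exact .single ⟨_, by simp, rfl⟩ ⟨_, by simp, rfl⟩ (h.adj_insert (by simp; grind)).symm
    · rintro ⟨k, hk⟩ A hA
      simp only [Set.mem_insert_iff, Set.mem_singleton_iff, not_or] at hk hA
      obtain ⟨l, hl⟩ := h3 k k hk.1 hk.2 hk.1 hk.2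
      simp only [Finset.mem_insert, Finset.mem_singleton, h.eq_iff]
      intro e
      simp only [Set.ext_iff, Set.mem_compl_iff] at e
      rcases hA with rfl | rfl | rfl <;> rcases e with (e | e) | (e | e) | (e | e) <;>
      · have := e p; have := e q; have := e k; have := e l
        simp only [Set.mem_insert_iff, Set.mem_singleton_iff, Set.mem_empty_iff_false] at *
        grind
    · rintro ⟨k, hk⟩ ⟨k', hk'⟩ hkk A hA B hB
      simp only [Set.mem_insert_iff, Set.mem_singleton_iff, not_or] at hk hA hk' hB
      obtain ⟨l, hl⟩ := h3 k k' hk.1 hk.2 hk'.1 hk'.2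
      have : k ≠ k' := fun e => hkk (by simp [e])
      rw [← not_or, Set.ext_iff, Set.ext_iff]
      intro e
      rcases hA with rfl | rfl | rfl <;> rcases hB with rfl | rfl | rfl <;>
      rcases e with e | e <;>
      · have := e p; have := e q; have := e k; have := e k'; have := e l
        simp only [Set.mem_insert_iff, Set.mem_singleton_iff, Set.mem_compl_iff] at *
        grind
    · rintro ⟨k, hk⟩ s hs
      simp only [Set.mem_insert_iff, Set.mem_singleton_iff, not_or] at hk
      simp only [Finset.mem_insert, Finset.mem_singleton] at hs
      rcases hs with rfl | rfl | rfl
      · refine ⟨{p, k}, by simp, ?_⟩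
        rw [Set.pair_comm]
        exact h.adj_insert (by simpa using hk.1)
      · refine ⟨{q, k}, by simp, ?_⟩
        rw [Set.pair_comm]
        exact h.adj_insert (by simpa using hk.2)
      · exact ⟨{k}, by simp, by simpa using h.adj_insert (Set.notMem_empty k)⟩
  push Not at h3
  obtain ⟨a, b, hap, haq, hbp, hbq, hab⟩ := h3
  have hcov : ∀ w, w = p ∨ w = q ∨ w = a ∨ w = b := fun w => by
    have := hab w
    grind
  by_cases hne : a = b
  · subst hne
    -- with three generators, `{k}` is the complement of `{p, q}`
    refine h.hasInternallyDisjointTrees_of_adj (J := {k // k ∉ ({p, q} : Set ι)}) hJ hp hq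
      (fun k => {{k.1}}) ?_ ?_ ?_ ?_
    · rintro ⟨k, hk⟩
      refine ⟨{k}, by simp, ?_⟩
      rintro A rfl
      exact .refl
    · rintro ⟨k, hk⟩ A rfl
      simp only [Set.mem_insert_iff, Set.mem_singleton_iff, not_or] at hk
      simp only [Finset.mem_insert, Finset.mem_singleton, h.eq_iff, Set.ext_iff, Set.mem_compl_iff]
      intro e
      rcases e with (e | e) | (e | e) | (e | e) <;>
      · have := e p; have := e q; have := e k
        simp only [Set.mem_singleton_iff, Set.mem_empty_iff_false] at *
        grind
    · rintro ⟨k, hk⟩ ⟨k', hk'⟩ hkk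
      refine (hkk (Subtype.ext ?_)).elim
      have := hcov k
      have := hcov k'
      simp only [Set.mem_insert_iff, Set.mem_singleton_iff, not_or] at hk hk'
      grind
    · rintro ⟨k, hk⟩ s hs
      simp only [Set.mem_insert_iff, Set.mem_singleton_iff, not_or] at hk
      simp only [Finset.mem_insert, Finset.mem_singleton] at hs
      refine ⟨{k}, rfl, ?_⟩
      rcases hs with rfl | rfl | rfl
      · refine h.adj_insert_compl (i := q) (by simpa using hpq.symm) ?_
        ext w
        have := hcov w
        have := hcov k
        simp only [Set.mem_insert_iff, Set.mem_singleton_iff, Set.mem_compl_iff]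
        grind
      · refine h.adj_insert_compl (i := p) (by simpa using hpq) ?_
        ext w
        have := hcov w
        have := hcov k
        simp only [Set.mem_insert_iff, Set.mem_singleton_iff, Set.mem_compl_iff]
        grind
      · simpa using h.adj_insert (Set.notMem_empty k)
  · have h2 : ∀ k, k ≠ p → k ≠ q → ∃ l, l ≠ p ∧ l ≠ q ∧ l ≠ k ∧
        ∀ w, w = p ∨ w = q ∨ w = k ∨ w = l := by
      intro k hkp hkq
      rcases hcov k with e | e | rfl | rfl
      · exact (hkp e).elim
      · exact (hkq e).elim
      · exact ⟨b, hbp, hbq, Ne.symm hne, hcov⟩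
      · exact ⟨a, hap, haq, hne, fun w => by have := hcov w; grind⟩
    refine h.hasInternallyDisjointTrees_of_adj (J := {k // k ∉ ({p, q} : Set ι)}) hJ hp hq
      (fun k => {{k.1}, {p, k.1}}) ?_ ?_ ?_ ?_
    · rintro ⟨k, hk⟩
      simp only [Set.mem_insert_iff, Set.mem_singleton_iff, not_or] at hk
      refine ⟨{k}, by simp, ?_⟩
      rintro A (rfl | rfl)
      · exact .refl
      · exact .single ⟨_, by simp, rfl⟩ ⟨_, by simp, rfl⟩ (h.adj_insert (by simp; grind)).symm
    · rintro ⟨k, hk⟩ A hA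
      simp only [Set.mem_insert_iff, Set.mem_singleton_iff, not_or] at hk hA
      obtain ⟨l, hl⟩ := h2 k hk.1 hk.2
      simp only [Finset.mem_insert, Finset.mem_singleton, h.eq_iff]
      intro e
      simp only [Set.ext_iff, Set.mem_compl_iff] at e
      rcases hA with rfl | rfl <;> rcases e with (e | e) | (e | e) | (e | e) <;>
      · have := e p; have := e q; have := e k; have := e l
        simp only [Set.mem_insert_iff, Set.mem_singleton_iff, Set.mem_empty_iff_false] at *
        grind
    · rintro ⟨k, hk⟩ ⟨k', hk'⟩ hkk A hA B hB
      simp only [Set.mem_insert_iff, Set.mem_singleton_iff, not_or] at hk hA hk' hB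
      have : k ≠ k' := fun e => hkk (by simp [e])
      rw [← not_or, Set.ext_iff, Set.ext_iff]
      intro e
      rcases hA with rfl | rfl <;> rcases hB with rfl | rfl <;> rcases e with e | e <;>
      · have := e p; have := e q; have := e k; have := e k'
        simp only [Set.mem_insert_iff, Set.mem_singleton_iff, Set.mem_compl_iff] at *
        grind
    · rintro ⟨k, hk⟩ s hs
      simp only [Set.mem_insert_iff, Set.mem_singleton_iff, not_or] at hk
      simp only [Finset.mem_insert, Finset.mem_singleton] at hs
      obtain ⟨l, hlp, hlq, hlk, hl⟩ := h2 k hk.1 hk.2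
      rcases hs with rfl | rfl | rfl
      · refine ⟨{p, k}, by simp, ?_⟩
        rw [Set.pair_comm]
        exact h.adj_insert (by simpa using hk.1)
      · -- with four generators, `{q, l}` is the complement of `{p, k}`
        refine ⟨{p, k}, by simp, h.adj_insert_compl (i := l) (by simpa using hlq) ?_⟩
        ext w
        have := hl w
        simp only [Set.mem_insert_iff, Set.mem_singleton_iff, Set.mem_compl_iff]
        grind
      · exact ⟨{k}, by simp, by simpa using h.adj_insert (Set.notMem_empty k)⟩

/-- Two of the terminals are named by `{p}` and `{q}`, the third one by a singleton `{a}`.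
Then `∅` is adjacent to all three; the other trees have the centres `{p, q, a}`, which is adjacent
to `{p, a}` and `{q, a}`, and `{k}` with `k ≠ p, q, a`. With four generators `{k}` is the
complement of `{p, q, a}`, and a tree with the centre `{a, k}` is used instead. -/
theorem hasTrees_singleton [Finite ι] [DecidableEq V] (h : IsFoldedNaming G φ) {p q a : ι}
    (hpq : p ≠ q) (hap : a ≠ p) (haq : a ≠ q) {n : ℕ} (hι : Nat.card ι = n + 1)
    (hex : ∃ k, k ≠ p ∧ k ≠ q ∧ k ≠ a) :
    HasInternallyDisjointTrees G {φ {p}, φ {q}, φ {a}} n := by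
  classical
  have hJ : n ≤ Nat.card {k // k ≠ q} := by
    have h1 := Set.ncard_add_ncard_compl ({q} : Set ι)
    rw [Set.ncard_singleton, hι] at h1
    have h2 : Nat.card {k // k ≠ q} = ({q} : Set ι)ᶜ.ncard := rfl
    omega
  -- the trees are indexed by the elements other than `q`; the centre `∅` belongs to the index `p`
  -- and the centre `{p, q, a}` to the index `a`
  by_cases h3 : ∀ k, k ≠ p → k ≠ q → k ≠ a → ∃ l, l ≠ p ∧ l ≠ q ∧ l ≠ a ∧ l ≠ k
  · refine h.hasInternallyDisjointTrees (J := {k // k ≠ q}) hJ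
      (fun k => if k.1 = p then {∅} else if k.1 = a then {{p, q, a}, {p, a}, {q, a}}
        else {{k.1}, {p, k.1}, {q, k.1}, {a, k.1}}) ?_ ?_ ?_ ?_
    · rintro ⟨k, hk⟩
      dsimp only
      split_ifs with h1 h2
      · exact ⟨∅, rfl, by rintro A rfl; exact .refl⟩
      · refine ⟨{p, q, a}, by simp, ?_⟩
        rintro A (rfl | rfl | rfl)
        · exact .refl
        · refine .single ⟨_, by simp, rfl⟩ ⟨_, by simp, rfl⟩ ?_
          rw [Set.insert_comm]
          exact h.adj_insert (by simp; grind)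
        · exact .single ⟨_, by simp, rfl⟩ ⟨_, by simp, rfl⟩ (h.adj_insert (by simp; grind))
      · refine ⟨{k}, by simp, ?_⟩
        rintro A (rfl | rfl | rfl | rfl)
        · exact .refl
        all_goals
          exact .single ⟨_, by simp, rfl⟩ ⟨_, by simp, rfl⟩ (h.adj_insert (by simp; grind)).symm
    · rintro ⟨k, hk⟩ A hA
      obtain ⟨k', hk'⟩ := hex
      obtain ⟨l, hl⟩ := h3 k' hk'.1 hk'.2.1 hk'.2.2
      simp only [Finset.mem_insert, Finset.mem_singleton, h.eq_iff]
      intro e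
      simp only [Set.ext_iff, Set.mem_compl_iff] at e
      dsimp only at hA
      split_ifs at hA with h1 h2 <;>
      simp only [Set.mem_insert_iff, Set.mem_singleton_iff] at hA
      on_goal 1 => subst hA
      on_goal 2 => rcases hA with rfl | rfl | rfl
      on_goal 5 => rcases hA with rfl | rfl | rfl | rfl
      all_goals
        rcases e with (e | e) | (e | e) | (e | e) <;>
        · have := e p; have := e q; have := e a; have := e k; have := e k'; have := e l
          simp only [Set.mem_insert_iff, Set.mem_singleton_iff, Set.mem_empty_iff_false] at *
          grind
    · rintro ⟨k, hk⟩ ⟨k', hk'⟩ hkk A hA B hB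
      have hkk' : k ≠ k' := fun e => hkk (by simp [e])
      obtain ⟨c, hc⟩ := hex
      obtain ⟨d, hd⟩ := h3 c hc.1 hc.2.1 hc.2.2
      dsimp only at hA hB
      split_ifs at hA hB <;>
      simp only [Set.mem_insert_iff, Set.mem_singleton_iff] at hA hB <;>
      (try casesm* _ ∨ _) <;> subst A B <;>
      rw [← not_or, Set.ext_iff, Set.ext_iff] <;>
      rintro (e | e) <;>
      · have := e p; have := e q; have := e a; have := e k; have := e k'; have := e c; have := e d
        clear e
        simp only [Set.mem_insert_iff, Set.mem_singleton_iff, Set.mem_empty_iff_false,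
          Set.mem_compl_iff] at *
        grind
    · rintro ⟨k, hk⟩ s hs
      simp only [Finset.mem_insert, Finset.mem_singleton] at hs
      dsimp only
      split_ifs with h1 h2
      · refine ⟨∅, rfl, ?_⟩
        rcases hs with rfl | rfl | rfl <;>
          simpa using (h.adj_insert (Set.notMem_empty _)).symm
      · rcases hs with rfl | rfl | rfl
        · refine ⟨{p, a}, by simp, ?_⟩
          rw [Set.pair_comm]
          exact h.adj_insert (by simpa using hap)
        · refine ⟨{q, a}, by simp, ?_⟩
          rw [Set.pair_comm]
          exact h.adj_insert (by simpa using haq)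
        · exact ⟨{p, a}, by simp, h.adj_insert (by simpa using hap.symm)⟩
      · rcases hs with rfl | rfl | rfl
        · refine ⟨{p, k}, by simp, ?_⟩
          rw [Set.pair_comm]
          exact h.adj_insert (by simpa using h1)
        · refine ⟨{q, k}, by simp, ?_⟩
          rw [Set.pair_comm]
          exact h.adj_insert (by simpa using hk)
        · refine ⟨{a, k}, by simp, ?_⟩
          rw [Set.pair_comm]
          exact h.adj_insert (by simpa using h2)
  · push Not at h3
    obtain ⟨c, hcp, hcq, hca, hc⟩ := h3
    have hcov : ∀ w, w = p ∨ w = q ∨ w = a ∨ w = c := fun w => by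
      have := hc w
      grind
    refine h.hasInternallyDisjointTrees (J := {k // k ≠ q}) hJ
      (fun k => if k.1 = p then {∅} else if k.1 = a then {{p, q, a}, {p, a}, {q, a}}
        else {{a, c}}) ?_ ?_ ?_ ?_
    · rintro ⟨k, hk⟩
      dsimp only
      split_ifs with h1 h2
      · exact ⟨∅, rfl, by rintro A rfl; exact .refl⟩
      · refine ⟨{p, q, a}, by simp, ?_⟩
        rintro A (rfl | rfl | rfl)
        · exact .refl
        · refine .single ⟨_, by simp, rfl⟩ ⟨_, by simp, rfl⟩ ?_
          rw [Set.insert_comm]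
          exact h.adj_insert (by simp; grind)
        · exact .single ⟨_, by simp, rfl⟩ ⟨_, by simp, rfl⟩ (h.adj_insert (by simp; grind))
      · exact ⟨{a, c}, rfl, by rintro A rfl; exact .refl⟩
    · rintro ⟨k, hk⟩ A hA
      dsimp only at hA
      split_ifs at hA <;>
      simp only [Set.mem_insert_iff, Set.mem_singleton_iff] at hA <;>
      (try casesm* _ ∨ _) <;> subst A <;>
      simp only [Finset.mem_insert, Finset.mem_singleton, h.eq_iff, Set.ext_iff,
        Set.mem_compl_iff] <;>
      rintro ((e | e) | (e | e) | (e | e)) <;>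
      · have := e p; have := e q; have := e a; have := e c; have := e k
        clear e
        simp only [Set.mem_insert_iff, Set.mem_singleton_iff, Set.mem_empty_iff_false] at *
        grind
    · rintro ⟨k, hk⟩ ⟨k', hk'⟩ hkk A hA B hB
      have hkk' : k ≠ k' := fun e => hkk (by simp [e])
      have hk4 := hcov k
      have hk4' := hcov k'
      dsimp only at hA hB
      split_ifs at hA hB <;>
      simp only [Set.mem_insert_iff, Set.mem_singleton_iff] at hA hB
      on_goal 9 => grind
      all_goals
        clear hk4 hk4'
        (try casesm* _ ∨ _) <;> subst A B <;>
        rw [← not_or, Set.ext_iff, Set.ext_iff] <;>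
        rintro (e | e) <;>
        · have := e p; have := e q; have := e a; have := e c
          clear e
          simp only [Set.mem_insert_iff, Set.mem_singleton_iff, Set.mem_empty_iff_false,
            Set.mem_compl_iff] at *
          grind
    · rintro ⟨k, hk⟩ s hs
      simp only [Finset.mem_insert, Finset.mem_singleton] at hs
      dsimp only
      split_ifs with h1 h2
      · refine ⟨∅, rfl, ?_⟩
        rcases hs with rfl | rfl | rfl <;>
          simpa using (h.adj_insert (Set.notMem_empty _)).symm
      · rcases hs with rfl | rfl | rfl
        · refine ⟨{p, a}, by simp, ?_⟩
          rw [Set.pair_comm]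
          exact h.adj_insert (by simpa using hap)
        · refine ⟨{q, a}, by simp, ?_⟩
          rw [Set.pair_comm]
          exact h.adj_insert (by simpa using haq)
        · exact ⟨{p, a}, by simp, h.adj_insert (by simpa using hap.symm)⟩
      · -- with four generators, `{a, c}` is the complement of `{p, q}`
        refine ⟨{a, c}, rfl, ?_⟩
        rcases hs with rfl | rfl | rfl
        · refine h.adj_insert_compl (i := q) (by simpa using hpq.symm) ?_
          ext w
          have := hcov w
          simp only [Set.mem_insert_iff, Set.mem_singleton_iff, Set.mem_compl_iff]
          grind
        · refine h.adj_insert_compl (i := p) (by simpa using hpq) ?_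
          ext w
          have := hcov w
          simp only [Set.mem_insert_iff, Set.mem_singleton_iff, Set.mem_compl_iff]
          grind
        · rw [Set.pair_comm]
          exact h.adj_insert (by simpa using hca)

set_option maxHeartbeats 4000000 in
/-- Two of the terminals are named by `{p}` and `{q}`, the third one by a set `B` of at least two
elements whose complement `C` in the remaining generators has at least two elements, too. There is
one tree for each `k ∈ B ∪ C`. In general it contains `{p, k}` and `{q, k}`; for `k ∈ C` these are
joined through `{k}`, from which a path adds the elements of `B` and ends at the neighbour
`B ∪ {k}` of `B`; for `k ∈ B` they are joined through `{p, q, k}`, from which a path adds the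
elements of `C` and ends at the complement of the neighbour `B \ {k}` of `B`.

One more tree, with the index `p`, contains the common neighbour `∅` of `{p}` and `{q}`. From there
it can only go on to some `{j}`; for a fixed `j ∈ C` it proceeds to `C` and then to `C ∪ {q}`, the
complement of `B ∪ {p}`. Therefore the tree of `j` is exceptional: it goes from
`{p, j}` to `C ∪ {p}`, the complement of `B ∪ {q}`, and to `{q, j}` by a detour through `b ∈ B`.
To stay clear of these two trees, the paths of the other ones add `b` first and `j` last,
respectively. The trees may contain all vertices that such paths could use. -/
theorem hasTrees_of_two_le [Finite ι] [DecidableEq V] (h : IsFoldedNaming G φ) {p q : ι}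
    (hpq : p ≠ q) {B C : Set ι} (hC : ∀ w, w ∈ C ↔ w ≠ p ∧ w ≠ q ∧ w ∉ B) (hpB : p ∉ B)
    (hqB : q ∉ B) {b b' j j' : ι} (hb : b ∈ B) (hb' : b' ∈ B) (hbb : b' ≠ b) (hj : j ∈ C)
    (hj' : j' ∈ C) (hjj : j' ≠ j) {n : ℕ} (hι : Nat.card ι = n + 1) :
    HasInternallyDisjointTrees G {φ {p}, φ {q}, φ B} n := by
  classical
  have hJ : n ≤ Nat.card {k // k ≠ q} := by
    have h1 := Set.ncard_add_ncard_compl ({q} : Set ι)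
    rw [Set.ncard_singleton, hι] at h1
    have h2 : Nat.card {k // k ≠ q} = ({q} : Set ι)ᶜ.ncard := rfl
    omega
  have hpC : p ∉ C := fun h => ((hC p).1 h).1 rfl
  have hqC : q ∉ C := fun h => ((hC q).1 h).2.1 rfl
  have hBC : ∀ w, w ∈ B → w ∉ C := fun w hw h => ((hC w).1 h).2.2 hw
  have hcov : ∀ w, w = p ∨ w = q ∨ w ∈ B ∨ w ∈ C := fun w => by
    have := hC w
    grind
  clear hC
  have hbC := hBC b hb
  have hbC' := hBC b' hb'
  have hjB : j ∉ B := fun h => hBC j h hj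
  have hjB' : j' ∉ B := fun h => hBC j' h hj'
  refine h.hasInternallyDisjointTrees (J := {k // k ≠ q}) hJ
    (fun k => if k.1 = p then {A | A = ∅ ∨ A = insert q C ∨ (j ∈ A ∧ ∀ w ∈ A, w ∈ C)}
      else if k.1 = j then {A | A = {p, j, b} ∨ A = {p, q, j, b} ∨ A = {q, j, b} ∨ A = {q, j} ∨
        (p ∈ A ∧ j ∈ A ∧ ∀ w ∈ A, w = p ∨ w ∈ C)}
      else if k.1 ∈ B then {A | A = {p, k.1} ∨ A = {q, k.1} ∨
        (p ∈ A ∧ q ∈ A ∧ k.1 ∈ A ∧ (∀ w ∈ A, w = p ∨ w = q ∨ w = k.1 ∨ w ∈ C) ∧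
          (j ∈ A → ∀ w ∈ C, w ∈ A))}
      else {A | A = {p, k.1} ∨ A = {q, k.1} ∨
        (k.1 ∈ A ∧ (∀ w ∈ A, w = k.1 ∨ w ∈ B) ∧ (b ∉ A → ∀ w ∈ A, w = k.1))}) ?_ ?_ ?_ ?_
  · rintro ⟨k, hk⟩
    dsimp only
    split_ifs with h1 h2 h3
    · have hjm : ({j} : Set ι) ∈ {A : Set ι | A = ∅ ∨ A = insert q C ∨
          (j ∈ A ∧ ∀ w ∈ A, w ∈ C)} := by simp [hj]
      have hsub : ∀ A : Set ι, j ∈ A → (∀ w ∈ A, w ∈ C) → ReachableWithin G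
          (φ '' {A | A = ∅ ∨ A = insert q C ∨ (j ∈ A ∧ ∀ w ∈ A, w ∈ C)}) (φ A) (φ {j}) := by
        intro A hjA hA
        refine h.reachableWithin_of_subcube ?_
        intro X hX hX'
        refine ⟨X, Or.inr (Or.inr ⟨hX ⟨hjA, rfl⟩, fun w hw => ?_⟩), rfl⟩
        rcases hX' hw with hw | rfl
        exacts [hA w hw, hj]
      refine ⟨{j}, hjm, ?_⟩
      rintro A (rfl | rfl | ⟨hA, hA'⟩)
      · exact .single ⟨_, Or.inl rfl, rfl⟩ ⟨_, hjm, rfl⟩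
          (by simpa using h.adj_insert (Set.notMem_empty j))
      · exact .trans (.single ⟨_, Or.inr (Or.inl rfl), rfl⟩
          ⟨C, Or.inr (Or.inr ⟨hj, fun _ => id⟩), rfl⟩ (h.adj_insert hqC).symm)
          (hsub C hj fun _ => id)
      · exact hsub A hA hA'
    · set 𝒲 : Set (Set ι) := {A | A = {p, j, b} ∨ A = {p, q, j, b} ∨ A = {q, j, b} ∨
        A = {q, j} ∨ (p ∈ A ∧ j ∈ A ∧ ∀ w ∈ A, w = p ∨ w ∈ C)} with h𝒲
      have m0 : ({p, j} : Set ι) ∈ 𝒲 := by simp [h𝒲, hj]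
      have m1 : ({p, j, b} : Set ι) ∈ 𝒲 := by simp [h𝒲]
      have m2 : ({p, q, j, b} : Set ι) ∈ 𝒲 := by simp [h𝒲]
      have m3 : ({q, j, b} : Set ι) ∈ 𝒲 := by simp [h𝒲]
      have m4 : ({q, j} : Set ι) ∈ 𝒲 := by simp [h𝒲]
      have a1 : ReachableWithin G (φ '' 𝒲) (φ {p, j, b}) (φ {p, j}) := by
        refine .single ⟨_, m1, rfl⟩ ⟨_, m0, rfl⟩ ?_
        rw [Set.pair_comm j b, Set.insert_comm p b]
        exact (h.adj_insert (by simp; grind)).symm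
      have a2 : ReachableWithin G (φ '' 𝒲) (φ {p, q, j, b}) (φ {p, j, b}) := by
        refine .single ⟨_, m2, rfl⟩ ⟨_, m1, rfl⟩ ?_
        rw [Set.insert_comm p q]
        exact (h.adj_insert (by simp; grind)).symm
      have a3 : ReachableWithin G (φ '' 𝒲) (φ {q, j, b}) (φ {p, q, j, b}) :=
        .single ⟨_, m3, rfl⟩ ⟨_, m2, rfl⟩ (h.adj_insert (by simp; grind))
      have a4 : ReachableWithin G (φ '' 𝒲) (φ {q, j}) (φ {q, j, b}) := by
        refine .single ⟨_, m4, rfl⟩ ⟨_, m3, rfl⟩ ?_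
        rw [Set.pair_comm j b, Set.insert_comm q b]
        exact h.adj_insert (by simp; grind)
      refine ⟨{p, j}, m0, ?_⟩
      rintro A (rfl | rfl | rfl | rfl | ⟨hpA, hjA, hA⟩)
      · exact a1
      · exact a2.trans a1
      · exact a3.trans (a2.trans a1)
      · exact a4.trans (a3.trans (a2.trans a1))
      · refine h.reachableWithin_of_subcube fun X hX hX' => ⟨X, Or.inr (Or.inr (Or.inr (Or.inr
          ⟨hX ⟨hpA, by simp⟩, hX ⟨hjA, by simp⟩, fun w hw => ?_⟩))), rfl⟩
        rcases hX' hw with hw | rfl | rfl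
        exacts [hA w hw, Or.inl rfl, Or.inr hj]
    · set 𝒲 : Set (Set ι) := {A | A = {p, k} ∨ A = {q, k} ∨ (p ∈ A ∧ q ∈ A ∧ k ∈ A ∧
        (∀ w ∈ A, w = p ∨ w = q ∨ w = k ∨ w ∈ C) ∧ (j ∈ A → ∀ w ∈ C, w ∈ A))} with h𝒲
      have m0 : ({p, q, k} : Set ι) ∈ 𝒲 := by
        have : j ≠ p ∧ j ≠ q ∧ j ≠ k := by grind
        simp [h𝒲, this]
      have hsub : ∀ A : Set ι, p ∈ A → q ∈ A → k ∈ A →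
          (∀ w ∈ A, w = p ∨ w = q ∨ w = k ∨ w ∈ C) → j ∉ A →
          ReachableWithin G (φ '' 𝒲) (φ A) (φ {p, q, k}) := by
        intro A hp hq hkA hA hjA
        have hX1 : ∀ X : Set ι, X ⊆ A ∪ {p, q, k} → ∀ w ∈ X, w ∈ A := by
          intro X hX w hw
          rcases hX hw with hw | rfl | rfl | rfl
          exacts [hw, hp, hq, hkA]
        refine h.reachableWithin_of_subcube ?_
        intro X hX hX'
        exact ⟨X, Or.inr (Or.inr ⟨hX ⟨hp, by simp⟩, hX ⟨hq, by simp⟩, hX ⟨hkA, by simp⟩,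
            fun w hw => hA w (hX1 X hX' w hw), fun hjX => (hjA (hX1 X hX' j hjX)).elim⟩), rfl⟩
      refine ⟨{p, q, k}, m0, ?_⟩
      rintro A (rfl | rfl | ⟨hp, hq, hkA, hA, hA'⟩)
      · refine .single ⟨_, Or.inl rfl, rfl⟩ ⟨_, m0, rfl⟩ ?_
        rw [Set.insert_comm p q]
        exact h.adj_insert (by simp; grind)
      · exact .single ⟨_, Or.inr (Or.inl rfl), rfl⟩ ⟨_, m0, rfl⟩ (h.adj_insert (by simp; grind))
      · by_cases hjA : j ∈ A
        · have hadj := h.adj_insert (A := A \ {j}) (i := j) (by simp)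
          rw [Set.insert_sdiff_singleton, Set.insert_eq_of_mem hjA] at hadj
          have hjp : p ≠ j := by grind
          have hjq : q ≠ j := by grind
          have hjk : k ≠ j := by grind
          refine .trans (.single ⟨A, Or.inr (Or.inr ⟨hp, hq, hkA, hA, hA'⟩), rfl⟩
            ⟨A \ {j}, Or.inr (Or.inr ⟨⟨hp, hjp⟩, ⟨hq, hjq⟩, ⟨hkA, hjk⟩, fun w hw => hA w hw.1,
              fun hj => (hj.2 rfl).elim⟩), rfl⟩ hadj.symm) ?_
          exact hsub _ ⟨hp, hjp⟩ ⟨hq, hjq⟩ ⟨hkA, hjk⟩ (fun w hw => hA w hw.1) fun hj => hj.2 rfl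
        · exact hsub A hp hq hkA hA hjA
    · set 𝒲 : Set (Set ι) := {A | A = {p, k} ∨ A = {q, k} ∨
        (k ∈ A ∧ (∀ w ∈ A, w = k ∨ w ∈ B) ∧ (b ∉ A → ∀ w ∈ A, w = k))} with h𝒲
      have m0 : ({k} : Set ι) ∈ 𝒲 := by simp [h𝒲]
      have m1 : ({b, k} : Set ι) ∈ 𝒲 := by simp [h𝒲, hb]
      refine ⟨{k}, m0, ?_⟩
      rintro A (rfl | rfl | ⟨hkA, hA, hA'⟩)
      · exact .single ⟨_, Or.inl rfl, rfl⟩ ⟨_, m0, rfl⟩ (h.adj_insert (by simp; grind)).symm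
      · exact .single ⟨_, Or.inr (Or.inl rfl), rfl⟩ ⟨_, m0, rfl⟩
          (h.adj_insert (by simp; grind)).symm
      · by_cases hbA : b ∈ A
        · have : ReachableWithin G (φ '' 𝒲) (φ A) (φ {b, k}) := by
            refine h.reachableWithin_of_subcube fun X hX hX' => ⟨X, Or.inr (Or.inr
              ⟨hX ⟨hkA, by simp⟩, fun w hw => ?_, fun hbX => (hbX (hX ⟨hbA, by simp⟩)).elim⟩), rfl⟩
            rcases hX' hw with hw | rfl | rfl
            exacts [hA w hw, Or.inr hb, Or.inl rfl]
          exact this.trans (ReachableWithin.single ⟨_, m1, rfl⟩ ⟨_, m0, rfl⟩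
            (h.adj_insert (by simp; grind)).symm)
        · have : A = {k} := Set.eq_singleton_iff_unique_mem.2 ⟨hkA, hA' hbA⟩
          rw [this]
          exact .refl
  · rintro ⟨k, hk⟩ A hA
    dsimp only at hA
    split_ifs at hA <;>
    simp only [Set.mem_ofPred_eq] at hA <;>
    (try casesm* _ = _ ∨ _) <;> (try subst A) <;>
    simp only [Finset.mem_insert, Finset.mem_singleton, h.eq_iff, Set.ext_iff,
      Set.mem_compl_iff] <;>
    rintro ((e | e) | (e | e) | (e | e)) <;>
    · have := e p; have := e q; have := e b; have := e b'; have := e j; have := e j'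
      have := e k; have := hcov k
      clear e
      try simp only [Set.mem_insert_iff, Set.mem_singleton_iff, Set.mem_empty_iff_false] at *
      grind
  · rintro ⟨k, hk⟩ ⟨k', hk'⟩ hkk A hA D hD
    have hkk' : k ≠ k' := fun e => hkk (by simp [e])
    dsimp only at hA hD
    split_ifs at hA hD <;>
    simp only [Set.mem_ofPred_eq] at hA hD <;>
    (try casesm* _ = _ ∨ _) <;> (try subst A) <;> (try subst D) <;>
    rw [← not_or, Set.ext_iff, Set.ext_iff] <;>
    rintro (e | e) <;>
    · have := e p; have := e q; have := e b; have := e b'; have := e j; have := e j'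
      have := e k; have := e k'; have := hcov k; have := hcov k'
      clear e
      try simp only [Set.mem_insert_iff, Set.mem_singleton_iff, Set.mem_empty_iff_false,
        Set.mem_compl_iff] at *
      grind
  · rintro ⟨k, hk⟩ s hs
    have hk4 := hcov k
    simp only [Finset.mem_insert, Finset.mem_singleton] at hs
    dsimp only
    split_ifs with h1 h2 h3
    · rcases hs with rfl | rfl | rfl
      · exact ⟨∅, by simp, by simpa using (h.adj_insert (Set.notMem_empty _)).symm⟩
      · exact ⟨∅, by simp, by simpa using (h.adj_insert (Set.notMem_empty _)).symm⟩
      · refine ⟨insert q C, by simp, h.adj_insert_compl hpB ?_⟩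
        ext w
        have := hcov w
        have := hBC w
        simp only [Set.mem_insert_iff, Set.mem_compl_iff]
        grind
    · subst h2
      rcases hs with rfl | rfl | rfl
      · refine ⟨{k, p}, ?_, h.adj_insert (by simpa using h1)⟩
        simp only [Set.mem_ofPred_eq, Set.mem_insert_iff, Set.mem_singleton_iff]
        grind
      · refine ⟨{q, k}, by simp, ?_⟩
        rw [Set.pair_comm]
        exact h.adj_insert (by simpa using hk)
      · refine ⟨insert p C, ?_, h.adj_insert_compl hqB ?_⟩
        · simp only [Set.mem_ofPred_eq, Set.mem_insert_iff]
          grind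
        ext w
        have := hcov w
        have := hBC w
        simp only [Set.mem_insert_iff, Set.mem_compl_iff]
        grind
    · rcases hs with rfl | rfl | rfl
      · refine ⟨{p, k}, by simp, ?_⟩
        rw [Set.pair_comm]
        exact h.adj_insert (by simpa using h1)
      · refine ⟨{q, k}, by simp, ?_⟩
        rw [Set.pair_comm]
        exact h.adj_insert (by simpa using hk)
      · refine ⟨(B \ {k})ᶜ, ?_, ?_⟩
        · simp only [Set.mem_ofPred_eq, Set.mem_compl_iff, Set.mem_sdiff, Set.mem_singleton_iff]
          refine Or.inr (Or.inr ⟨by simp [hpB], by simp [hqB], by simp, fun w hw => ?_,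
            fun _ w hw => ?_⟩)
          · have := hcov w
            grind
          · have := hBC w
            grind
        · rw [h.compl]
          have := h.adj_insert (A := B \ {k}) (i := k) (by simp)
          rw [Set.insert_sdiff_singleton, Set.insert_eq_of_mem h3] at this
          exact this.symm
    · rcases hs with rfl | rfl | rfl
      · refine ⟨{p, k}, by simp, ?_⟩
        rw [Set.pair_comm]
        exact h.adj_insert (by simpa using h1)
      · refine ⟨{q, k}, by simp, ?_⟩
        rw [Set.pair_comm]
        exact h.adj_insert (by simpa using hk)
      · refine ⟨insert k B, ?_, h.adj_insert h3⟩
        simp only [Set.mem_ofPred_eq, Set.mem_insert_iff]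
        grind

theorem hasTrees_of_pair_of_card [Finite ι] [DecidableEq V] (h : IsFoldedNaming G φ) {p q : ι}
    (hpq : p ≠ q) {B : Set ι} (hpB : p ∉ B) (hqB : q ∉ B)
    (hB : B = ∅ ∨ (∃ a, B = {a} ∧ ∃ k, k ≠ p ∧ k ≠ q ∧ k ≠ a) ∨ (∃ b ∈ B, ∃ b' ∈ B, b' ≠ b) ∧
      ∃ j j', j' ≠ j ∧ j ∉ insert p (insert q B) ∧ j' ∉ insert p (insert q B))
    {n : ℕ} (hι : Nat.card ι = n + 1) :
    HasInternallyDisjointTrees G {φ {p}, φ {q}, φ B} n := by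
  rcases hB with rfl | ⟨a, rfl, hk⟩ | ⟨⟨b, hb, b', hb', hbb⟩, j, j', hjj, hj, hj'⟩
  · exact h.hasTrees_path hpq hι
  · exact h.hasTrees_singleton hpq (Ne.symm hpB) (Ne.symm hqB) hι hk
  · exact h.hasTrees_of_two_le hpq (C := (insert p (insert q B))ᶜ) (fun w => by simp) hpB hqB
      hb hb' hbb hj hj' hjj hι

/-- Two of the terminals are named by `{p}` and `{q}`, the third one by a set `B` avoiding `p` and
`q`. The translation by `{p, q}` allows to replace `B` by the complement of `B ∪ {p, q}`. -/
theorem hasTrees_of_pair [Finite ι] [DecidableEq V] (h : IsFoldedNaming G φ) {p q : ι}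
    (hpq : p ≠ q) {B : Set ι} (hpB : p ∉ B) (hqB : q ∉ B)
    {n : ℕ} (hι : Nat.card ι = n + 1) :
    HasInternallyDisjointTrees G {φ {p}, φ {q}, φ B} n := by
  by_cases hB : B = ∅ ∨ (∃ a, B = {a} ∧ ∃ k, k ≠ p ∧ k ≠ q ∧ k ≠ a) ∨
      (∃ b ∈ B, ∃ b' ∈ B, b' ≠ b) ∧
        ∃ j j', j' ≠ j ∧ j ∉ insert p (insert q B) ∧ j' ∉ insert p (insert q B)
  · exact h.hasTrees_of_pair_of_card hpq hpB hqB hB hι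
  set C : Set ι := (insert p (insert q B))ᶜ with hC
  have hCB : ∀ w, w ∈ B ↔ w ∉ insert p (insert q C) := fun w => by
    simp only [hC, Set.mem_insert_iff, Set.mem_compl_iff]
    grind
  have hpair := (h.translate {p, q}).hasTrees_of_pair_of_card hpq (B := C) (by simp [hC])
    (by simp [hC]) ?_ hι
  · have e1 : ({p} : Set ι) ∆ {p, q} = {q} := by
      ext w
      simp only [Set.mem_symmDiff, Set.mem_insert_iff, Set.mem_singleton_iff]
      grind
    have e2 : ({q} : Set ι) ∆ {p, q} = {p} := by
      ext w
      simp only [Set.mem_symmDiff, Set.mem_insert_iff, Set.mem_singleton_iff]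
      grind
    have e3 : C ∆ {p, q} = Bᶜ := by
      ext w
      simp only [hC, Set.mem_symmDiff, Set.mem_insert_iff, Set.mem_singleton_iff, Set.mem_compl_iff]
      grind
    rwa [e1, e2, e3, h.compl, Finset.insert_comm] at hpair
  · push Not at hB
    obtain ⟨⟨b, hb⟩, h1, h2⟩ := hB
    by_cases hC0 : C = ∅
    · exact Or.inl hC0
    obtain ⟨j, hj⟩ := Set.nonempty_iff_ne_empty.2 hC0
    have hbC := (hCB b).1 hb
    simp only [Set.mem_insert_iff, not_or] at hbC
    right
    by_cases hC1 : ∃ j ∈ C, ∃ j' ∈ C, j' ≠ j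
    · right
      obtain ⟨j, hj, j', hj', hjj⟩ := hC1
      refine ⟨⟨j, hj, j', hj', hjj⟩, ?_⟩
      by_contra hno
      push Not at hno
      have : B = {b} := by
        refine Set.eq_singleton_iff_unique_mem.2 ⟨hb, fun w hw => ?_⟩
        by_contra hwb
        exact (hCB w).1 hw (hno b w hwb ((hCB b).1 hb))
      have hjb := h1 b this j
      simp only [hC, Set.mem_insert_iff, Set.mem_compl_iff] at hj
      grind
    · left
      push Not at hC1
      refine ⟨j, Set.eq_singleton_iff_unique_mem.2 ⟨hj, hC1 j hj⟩, b, hbC.1, hbC.2.1, ?_⟩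
      rintro rfl
      exact hbC.2.2 hj

/-! ### At most one class with a single generator -/

/-- The class of the generators of colour `k`. The colours stand for the elements of the Klein
four-group, with `^^^` as the group operation. -/
def part (c : ι → Fin 4) (k : Fin 4) : Set ι := {i | c i = k}

/-- Each `i` can choose a representative `F i k` of each nonempty class so that no `i` and `j` in
different classes of size at least two choose each other: between two classes with the elements
`a ≠ b` and `a' ≠ b'`, let the choices follow the cycle `a → b' → b → a' → a`. -/
theorem exists_choice [Nonempty ι] (c : ι → Fin 4) : ∃ F : ι → Fin 4 → ι,
    (∀ i k, (∃ w, c w = k) → c (F i k) = k) ∧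
    ∀ i j, (∃ i', c i' = c i ∧ i' ≠ i) → (∃ j', c j' = c j ∧ j' ≠ j) → c i ≠ c j →
      F i (c j) = j → F j (c i) = i → False := by
  have : ∀ k, ∃ a b : ι, (∀ w, c w = k → c a = k ∧ c b = k) ∧
      ((∃ w w', c w = k ∧ c w' = k ∧ w ≠ w') → a ≠ b) := by
    intro k
    by_cases h2 : ∃ w w', c w = k ∧ c w' = k ∧ w ≠ w'
    · obtain ⟨w, w', h1, h2, h3⟩ := h2
      exact ⟨w, w', fun _ _ => ⟨h1, h2⟩, fun _ => h3⟩
    · by_cases h1 : ∃ w, c w = k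
      · obtain ⟨w, hw⟩ := h1
        exact ⟨w, w, fun _ _ => ⟨hw, hw⟩, fun h => (h2 h).elim⟩
      · exact ⟨Classical.arbitrary ι, Classical.arbitrary ι, fun w hw => (h1 ⟨w, hw⟩).elim,
          fun h => (h2 h).elim⟩
  choose a b hc hab using this
  classical
  refine ⟨fun i k => if c i < k then (if i = a (c i) then b k else a k)
    else (if i = b (c i) then b k else a k), ?_, ?_⟩
  · rintro i k ⟨w, hw⟩
    have := hc k w hw
    grind
  · rintro i j ⟨i', hi', hii⟩ ⟨j', hj', hjj⟩ hij h1 h2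
    have h3 := hab (c i) ⟨i', i, hi', rfl, hii⟩
    have h4 := hab (c j) ⟨j', j, hj', rfl, hjj⟩
    rcases lt_or_gt_of_ne hij with hlt | hlt
    · have hlt' := hlt.not_gt
      simp only [hlt, hlt', if_true, if_false] at h1 h2
      grind
    · have hlt' := hlt.not_gt
      simp only [hlt, hlt', if_true, if_false] at h1 h2
      grind

/-- The tree with index `i` has a branch towards the terminal `t ≠ 0`, except if for some smaller
label `s` the class of `c i ^^^ t ^^^ s` is empty and the class of `i` has only two elements `i` and
`i'`. In the exceptional case the neighbour of the terminal `t` in direction `i'` is the neighbour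
of the terminal `s` in direction `i`, so that the branch towards `s` serves both terminals. -/
def Allowed (c : ι → Fin 4) (i : ι) (t : Fin 4) : Prop :=
  t ≠ 0 ∧ ∀ s, s ≠ 0 → s < t → (∃ w, c w = c i ^^^ t ^^^ s) ∨
    ∀ i', ∃ l, c l = c i ∧ l ≠ i ∧ l ≠ i'

/-- The vertex reached from the terminal `t` by the generator `i` and then by the generators
in `X`. -/
def branchName (c : ι → Fin 4) (i : ι) (t : Fin 4) (X : Set ι) : Set ι :=
  (part c t ∆ {i}) ∆ X

/-- The vertices of the branch towards the terminal `t` of the tree with index `i`: start from the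
terminal, apply the generator `i`, and then those of the class of `c i ^^^ t`, the one chosen by `i`
being the first. All possible orders of the other ones are admitted. -/
def branch (c : ι → Fin 4) (F : ι → Fin 4 → ι) (i : ι) (t : Fin 4) : Set (Set ι) :=
  {A | ∃ X ⊆ part c (c i ^^^ t), (X = ∅ ∨ F i (c i ^^^ t) ∈ X) ∧ A = branchName c i t X}

theorem mem_branchName (c : ι → Fin 4) (i : ι) (t : Fin 4) (X : Set ι) (w : ι) :
    w ∈ branchName c i t X ↔ ¬ ((c w = t) ↔ (w = i ↔ w ∉ X)) := by
  simp only [branchName, part, Set.mem_symmDiff, Set.mem_ofPred_eq, Set.mem_singleton_iff]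
  grind

theorem branchName_empty (c : ι → Fin 4) (i : ι) (t : Fin 4) :
    branchName c i t ∅ = part c t ∆ {i} := symmDiff_bot _

/-- Indices in different classes: if `s ≠ c i ^^^ c j`, the symmetric difference of the two names
contains exactly one of `i` and `i'`, so it is neither empty nor everything. -/
theorem branchName_ne_of_ne {c : ι → Fin 4} {i j : ι} {t s : Fin 4} {X Y : Set ι}
    (hX : X ⊆ part c (c i ^^^ t)) (hij : c i ≠ c j)
    (hi : ∃ i', c i' = c i ∧ i' ≠ i) (ht : t ≠ 0) (hs : s ≠ c i ^^^ c j)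
    (hY : Y ⊆ part c (c j ^^^ s)) :
    branchName c i t X ≠ branchName c j s Y ∧ branchName c i t X ≠ (branchName c j s Y)ᶜ := by
  obtain ⟨i', hi', hii⟩ := hi
  have d1 : ∀ k t : Fin 4, t ≠ 0 → k ≠ k ^^^ t := by decide
  have d2 : ∀ k l s : Fin 4, s ≠ k ^^^ l → k ≠ l ^^^ s := by decide
  have h1 := d1 (c i) t ht
  have h2 := d2 _ _ _ hs
  have x1 : i ∉ X := fun h => h1 (hX h)
  have x2 : i' ∉ X := fun h => h1 (hi'.symm.trans (hX h))
  have y1 : i ∉ Y := fun h => h2 (hY h)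
  have y2 : i' ∉ Y := fun h => h2 (hi'.symm.trans (hY h))
  have n1 : i ≠ j := fun e => hij (e ▸ rfl)
  have n2 : i' ≠ j := fun e => hij (hi'.symm.trans (e ▸ rfl))
  rw [← not_or, Set.ext_iff, Set.ext_iff]
  simp only [Set.mem_compl_iff, mem_branchName]
  rintro (e | e) <;>
  · have := e i
    have := e i'
    grind

/-- Indices in the same class, different labels. -/
theorem branchName_ne_of_lt {c : ι → Fin 4} {i j : ι} {t s : Fin 4} {X Y : Set ι}
    (hX : X ⊆ part c (c i ^^^ t)) (hij : c i = c j) (hne : i ≠ j)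
    (hs : s ≠ 0) (hst : s < t) (hi : Allowed c i t) (hY : Y ⊆ part c (c j ^^^ s)) :
    branchName c i t X ≠ branchName c j s Y ∧ branchName c i t X ≠ (branchName c j s Y)ᶜ := by
  have d1 : ∀ k t : Fin 4, t ≠ 0 → k ≠ k ^^^ t := by decide
  have h1 := d1 (c i) t hi.1
  have h2 := d1 (c j) s hs
  rw [← not_or, Set.ext_iff, Set.ext_iff]
  simp only [Set.mem_compl_iff, mem_branchName]
  have x1 : i ∉ X := fun h => h1 (hX h)
  have y1 : i ∉ Y := fun h => h2 (hij.symm.trans (hY h))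
  rcases hi.2 s hs hst with ⟨w, hw⟩ | h3
  · have d3 : ∀ k t s : Fin 4, t ≠ 0 → s ≠ 0 → s < t →
        k ^^^ t ^^^ s ≠ k ∧ k ^^^ t ^^^ s ≠ k ^^^ t ∧
        k ^^^ t ^^^ s ≠ k ^^^ s ∧
        (((k = t) ↔ ¬ (k = s)) ↔ ((k ^^^ t ^^^ s = t) ↔ ¬ (k ^^^ t ^^^ s = s))) := by decide
    obtain ⟨n1, n2, n3, n4⟩ := d3 (c i) t s hi.1 hs hst
    have x2 : w ∉ X := fun h => n2 (hw.symm.trans (hX h))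
    have y2 : w ∉ Y := fun h => n3 (hw.symm.trans ((hY h).trans (by rw [hij])))
    have n5 : w ≠ i := fun e => n1 (hw.symm.trans (e ▸ rfl))
    have n6 : w ≠ j := fun e => n1 (hw.symm.trans (e ▸ hij.symm))
    rintro (e | e) <;>
    · have := e i
      have := e w
      grind
  · obtain ⟨w, hw, n1, n2⟩ := h3 j
    have x2 : w ∉ X := fun h => h1 (hw.symm.trans (hX h))
    have y2 : w ∉ Y := fun h => h2 (hij.symm.trans (hw.symm.trans (hY h)))
    rintro (e | e) <;>
    · have := e i
      have := e w
      grind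

theorem branchName_ne_part {c : ι → Fin 4} {i : ι} {t s : Fin 4} {X : Set ι}
    (hX : X ⊆ part c (c i ^^^ t)) (hi : ∃ i', c i' = c i ∧ i' ≠ i) (ht : t ≠ 0) :
    branchName c i t X ≠ part c s ∧ branchName c i t X ≠ (part c s)ᶜ := by
  obtain ⟨i', hi', hii⟩ := hi
  have d1 : ∀ k t : Fin 4, t ≠ 0 → k ≠ k ^^^ t := by decide
  have h1 := d1 (c i) t ht
  have x1 : i ∉ X := fun h => h1 (hX h)
  have x2 : i' ∉ X := fun h => h1 (hi'.symm.trans (hX h))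
  rw [← not_or, Set.ext_iff, Set.ext_iff]
  simp only [Set.mem_compl_iff, mem_branchName, part, Set.mem_ofPred_eq]
  rintro (e | e) <;>
  · have := e i
    have := e i'
    grind

/-- Indices in the same class, equal labels. -/
theorem branchName_ne_of_label_eq {c : ι → Fin 4} {i j : ι} {t : Fin 4} {X Y : Set ι}
    (hne : ∀ k l, k ≠ l → ∃ w, c w = k ∨ c w = l)
    (hX : X ⊆ part c (c i ^^^ t)) (hij : c i = c j) (hne' : i ≠ j) (ht : t ≠ 0)
    (hY : Y ⊆ part c (c j ^^^ t)) :
    branchName c i t X ≠ branchName c j t Y ∧ branchName c i t X ≠ (branchName c j t Y)ᶜ := by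
  have d1 : ∀ k t : Fin 4, t ≠ 0 → k ≠ k ^^^ t ∧ ∃ m m', m ≠ m' ∧ m ≠ k ∧ m' ≠ k ∧
      m ≠ k ^^^ t ∧ m' ≠ k ^^^ t := by decide
  obtain ⟨h1, m, m', hm, m1, m2, m3, m4⟩ := d1 (c i) t ht
  obtain ⟨w, hw⟩ := hne m m' hm
  have w1 : c w ≠ c i := by rcases hw with rfl | rfl <;> assumption
  have w2 : c w ≠ c i ^^^ t := by rcases hw with rfl | rfl <;> assumption
  have x1 : i ∉ X := fun h => h1 (hX h)
  have y1 : i ∉ Y := fun h => h1 ((hY h).trans (by rw [hij]))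
  have x2 : w ∉ X := fun h => w2 (hX h)
  have y2 : w ∉ Y := fun h => w2 ((hY h).trans (by rw [hij]))
  have n1 : w ≠ i := fun e => w1 (e ▸ rfl)
  have n2 : w ≠ j := fun e => w1 (e ▸ hij.symm)
  rw [← not_or, Set.ext_iff, Set.ext_iff]
  simp only [Set.mem_compl_iff, mem_branchName]
  rintro (e | e) <;>
  · have := e i
    have := e w
    grind

/-- The only possible common vertex of two branches with indices in different classes is the one
obtained from a terminal by the generators `i` and `j`; each branch contains it only if its index
chooses the other one. -/
theorem branchName_eq_imp {c : ι → Fin 4} {i j : ι} {t : Fin 4} {X Y : Set ι}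
    (hne : ∀ k l, k ≠ l → ∃ w, c w = k ∨ c w = l)
    (hX : X ⊆ part c (c i ^^^ t)) (hij : c i ≠ c j) (ht : t = c i ^^^ c j)
    (hY : Y ⊆ part c (c j ^^^ t))
    (h : branchName c i t X = branchName c j t Y ∨ branchName c i t X = (branchName c j t Y)ᶜ) :
    X = {j} ∧ Y = {i} := by
  have d1 : ∀ k l : Fin 4, k ≠ l → k ^^^ (k ^^^ l) = l ∧ l ^^^ (k ^^^ l) = k ∧
      ∃ m m', m ≠ m' ∧ m ≠ k ∧ m' ≠ k ∧ m ≠ l ∧ m' ≠ l := by decide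
  obtain ⟨h1, h2, m, m', hm, m1, m2, m3, m4⟩ := d1 _ _ hij
  rw [← ht] at h1 h2
  rw [h1] at hX
  rw [h2] at hY
  obtain ⟨w, hw⟩ := hne m m' hm
  have w1 : c w ≠ c i := by rcases hw with rfl | rfl <;> assumption
  have w2 : c w ≠ c j := by rcases hw with rfl | rfl <;> assumption
  have hX' : ∀ v ∈ X, c v = c j := fun v hv => hX hv
  have hY' : ∀ v ∈ Y, c v = c i := fun v hv => hY hv
  rw [Set.ext_iff, Set.ext_iff] at h
  simp only [Set.mem_compl_iff, mem_branchName] at h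
  have e : ∀ v, (v = i ↔ v ∉ X) ↔ (v = j ↔ v ∉ Y) := by
    intro v
    rcases h with e | e
    · have := e v
      grind
    · have := e w
      grind
  constructor <;> ext v <;>
  · have := e v
    have := e i
    have := e j
    simp only [Set.mem_singleton_iff]
    grind

/-- The branches of a tree end at a common vertex. -/
theorem branchName_center (c : ι → Fin 4) (h : IsFoldedNaming G φ) (i : ι) (t s : Fin 4) :
    φ (branchName c i t (part c (c i ^^^ t))) = φ (branchName c i s (part c (c i ^^^ s))) := by
  have d : ∀ k t s : Fin 4, (∀ m, (m = t ↔ ¬ m = k ^^^ t) ↔ (m = s ↔ ¬ m = k ^^^ s)) ∨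
      ∀ m, (m = t ↔ ¬ m = k ^^^ t) ↔ ¬ (m = s ↔ ¬ m = k ^^^ s) := by decide
  rw [h.eq_iff]
  refine (d (c i) t s).imp (fun d => ?_) fun d => ?_ <;>
  · ext w
    have := d (c w)
    simp only [Set.mem_compl_iff, mem_branchName, part, Set.mem_ofPred_eq]
    grind

theorem reachableWithin_center [Finite ι] {c : ι → Fin 4} {F : ι → Fin 4 → ι}
    (hF : ∀ i k, (∃ w, c w = k) → c (F i k) = k) (h : IsFoldedNaming G φ) {i : ι} {t : Fin 4}
    {W : Set V} (hW : ∀ A ∈ branch c F i t, φ A ∈ W) {A : Set ι} (hA : A ∈ branch c F i t) :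
    ReachableWithin G W (φ A) (φ (branchName c i t (part c (c i ^^^ t)))) := by
  have hadd : ∀ X D : Set ι, (∀ w ∈ D, w ∉ X) →
      branchName c i t X ∆ D = branchName c i t (X ∪ D) := by
    intro X D hXD
    ext w
    have := hXD w
    simp only [Set.mem_symmDiff, mem_branchName, Set.mem_union]
    grind
  obtain ⟨X, hX, hXF, rfl⟩ := hA
  have hsub : ∀ X ⊆ part c (c i ^^^ t), F i (c i ^^^ t) ∈ X → ReachableWithin G W
      (φ (branchName c i t X)) (φ (branchName c i t (part c (c i ^^^ t)))) := by
    intro X hX hF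
    have := h.reachableWithin_symmDiff (W := W) (branchName c i t X) (part c (c i ^^^ t) \ X)
      (Set.toFinite _) fun D hD => ?_
    · rwa [hadd _ _ fun w hw => hw.2, Set.union_sdiff_cancel hX] at this
    · rw [hadd _ _ fun w hw => (hD hw).2]
      exact hW _ ⟨_, Set.union_subset hX fun w hw => (hD hw).1, Or.inr (Or.inl hF), rfl⟩
  rcases hXF with rfl | hXF
  · by_cases he : part c (c i ^^^ t) = ∅
    · rw [he]
      exact .refl
    · obtain ⟨w, hw⟩ := Set.nonempty_iff_ne_empty.2 he
      have hFc := hF i _ ⟨w, hw⟩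
      have hFs : {F i (c i ^^^ t)} ⊆ part c (c i ^^^ t) := Set.singleton_subset_iff.2 hFc
      refine .trans (.single (hW _ ⟨∅, Set.empty_subset _, Or.inl rfl, rfl⟩)
        (hW _ ⟨_, hFs, Or.inr rfl, rfl⟩) ?_) (hsub _ hFs rfl)
      have := h.adj (branchName c i t ∅) (F i (c i ^^^ t))
      rwa [hadd _ _ (by simp), Set.empty_union] at this
  · exact hsub X hX hXF

/-- If at most one class has exactly one element, the trees with indices in the larger classes are
at least `n` in number and internally disjoint. -/
theorem hasTrees_of_parts [Finite ι] [DecidableEq V] (h : IsFoldedNaming G φ) (c : ι → Fin 4)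
    (hne : ∀ k l, k ≠ l → ∃ w, c w = k ∨ c w = l)
    (hsmall : ∀ i j, (∀ i', c i' = c i → i' = i) → (∀ j', c j' = c j → j' = j) → i = j)
    {n : ℕ} (hι : Nat.card ι = n + 1) :
    HasInternallyDisjointTrees G {φ (part c 1), φ (part c 2), φ (part c 3)} n := by
  have hι' : Nonempty ι := (Nat.card_pos_iff.1 (by omega)).1
  have hJ : n ≤ Nat.card {i // ∃ i', c i' = c i ∧ i' ≠ i} := by
    have h1 := Set.ncard_add_ncard_compl {i | ∃ i', c i' = c i ∧ i' ≠ i}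
    have h2 : Set.ncard {i | ∃ i', c i' = c i ∧ i' ≠ i}ᶜ ≤ 1 := by
      rw [Set.ncard_le_one]
      intro i hi j hj
      simp only [Set.mem_compl_iff, Set.mem_ofPred_eq] at hi hj
      push Not at hi hj
      exact hsmall i j hi hj
    have h3 : Nat.card {i // ∃ i', c i' = c i ∧ i' ≠ i} =
      Set.ncard {i | ∃ i', c i' = c i ∧ i' ≠ i} := rfl
    omega
  obtain ⟨F, hF, hF'⟩ := exists_choice c
  have hS : ∀ s, s ∈ ({φ (part c 1), φ (part c 2), φ (part c 3)} : Finset V) →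
      ∃ t : Fin 4, t ≠ 0 ∧ s = φ (part c t) := by
    intro s hs
    simp only [Finset.mem_insert, Finset.mem_singleton] at hs
    rcases hs with rfl | rfl | rfl
    exacts [⟨1, by decide, rfl⟩, ⟨2, by decide, rfl⟩, ⟨3, by decide, rfl⟩]
  refine h.hasInternallyDisjointTrees hJ
    (fun i => {A | ∃ t, Allowed c i.1 t ∧ A ∈ branch c F i.1 t}) ?_ ?_ ?_ ?_
  · rintro ⟨i, hi⟩
    have h1 : Allowed c i 1 := ⟨by decide, fun s hs hs1 => by
      have : ∀ s : Fin 4, s ≠ 0 → ¬ s < 1 := by decide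
      exact (this s hs hs1).elim⟩
    refine ⟨branchName c i 1 (part c (c i ^^^ 1)), ⟨1, h1, _, subset_rfl, ?_, rfl⟩, ?_⟩
    · by_cases he : part c (c i ^^^ 1) = ∅
      · exact Or.inl he
      · obtain ⟨w, hw⟩ := Set.nonempty_iff_ne_empty.2 he
        exact Or.inr (hF i _ ⟨w, hw⟩)
    · rintro A ⟨t, ht, hA⟩
      rw [branchName_center c h i 1 t]
      refine reachableWithin_center hF h ?_ hA
      exact fun A hA => ⟨A, ⟨t, ht, hA⟩, rfl⟩
  · rintro ⟨i, hi⟩ A ⟨t, ht, X, hX, -, rfl⟩ hAS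
    obtain ⟨s, -, hs⟩ := hS _ hAS
    have := branchName_ne_part (s := s) hX hi ht.1
    exact ((h.eq_iff _ _).1 hs).elim this.1 this.2
  · -- only for indices in different classes and `t = s = c i ^^^ c j` are the choices needed
    rintro ⟨i, hi⟩ ⟨j, hj⟩ hij A ⟨t, ht, X, hX, hXF, rfl⟩ B ⟨s, hs, Y, hY, hYF, rfl⟩
    have hij' : i ≠ j := fun e => hij (by simp [e])
    have swap : ∀ {A B : Set ι}, B ≠ A ∧ B ≠ Aᶜ → A ≠ B ∧ A ≠ Bᶜ := fun h =>
      ⟨h.1.symm, fun e => h.2 (by rw [e, compl_compl])⟩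
    by_cases hcij : c i = c j
    · rcases lt_trichotomy t s with hts | rfl | hts
      · exact swap (branchName_ne_of_lt hY hcij.symm hij'.symm ht.1 hts hs hX)
      · exact branchName_ne_of_label_eq hne hX hcij hij' ht.1 hY
      · exact branchName_ne_of_lt hX hcij hij' hs.1 hts ht hY
    · by_cases h1 : s = c i ^^^ c j
      · by_cases h2 : t = c j ^^^ c i
        · have hc : c i ^^^ c j = c j ^^^ c i := Fin.xor_comm _ _
          have hts : t = s := h2.trans (hc.symm.trans h1.symm)
          subst hts
          rw [← not_or]
          intro e
          obtain ⟨rfl, rfl⟩ := branchName_eq_imp hne hX hcij h1 hY e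
          have d : ∀ k l : Fin 4, k ^^^ (k ^^^ l) = l ∧ l ^^^ (k ^^^ l) = k := by decide
          rw [h1, (d _ _).1] at hXF
          rw [h1, (d _ _).2] at hYF
          refine hF' i j hi hj hcij ?_ ?_
          · simpa using hXF
          · simpa using hYF
        · exact swap (branchName_ne_of_ne hY (Ne.symm hcij) hj hs.1 h2 hX)
      · exact branchName_ne_of_ne hX hcij hi ht.1 h1 hY
  · rintro ⟨i, hi⟩ s hs
    obtain ⟨s, hs0, rfl⟩ := hS s hs
    by_cases hal : Allowed c i s
    · refine ⟨branchName c i s ∅, ⟨s, hal, ∅, Set.empty_subset _, Or.inl rfl, rfl⟩, ?_⟩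
      rw [branchName_empty]
      exact h.adj _ _
    · -- the tree reaches the terminal `s` through the branch of a smaller label `t`
      simp only [Allowed, not_and] at hal
      have hal := hal hs0
      push Not at hal
      obtain ⟨t, ht0, hts, hempty, i', hi'⟩ := hal
      obtain ⟨i'', hi'', hii⟩ := hi
      obtain rfl : i'' = i' := hi' _ hi'' hii
      have halt : Allowed c i t := by
        refine ⟨ht0, fun u hu0 hut => Or.inl ?_⟩
        have d : ∀ k s t u : Fin 4, t < s → u < t → k ^^^ s ^^^ t ≠ k ^^^ t ^^^ u := by decide
        obtain ⟨w, hw⟩ := hne _ _ (d (c i) s t u hts hut)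
        exact ⟨w, hw.resolve_left (hempty w)⟩
      refine ⟨branchName c i t ∅, ⟨t, halt, ∅, Set.empty_subset _, Or.inl rfl, rfl⟩, ?_⟩
      have e : φ (branchName c i t ∅) = φ (branchName c i'' s ∅) := by
        have d : ∀ k s t m : Fin 4, t < s ∧ m ≠ k ∧ m ≠ k ^^^ s ^^^ t →
            ((m = t ↔ ¬ m = s) ↔ ¬ (k = t ↔ ¬ k = s)) := by decide
        have e : ∀ w, (c w = c i ∧ (w = i ↔ ¬ w = i'')) ∨ (w ≠ i ∧ w ≠ i'' ∧
            ((c w = t ↔ ¬ c w = s) ↔ ¬ (c i = t ↔ ¬ c i = s))) := by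
          intro w
          by_cases hw : c w = c i
          · have := hi' w hw
            grind
          · have := d (c i) s t (c w) ⟨hts, hw, hempty w⟩
            grind
        rw [h.eq_iff]
        by_cases hi0 : c i = t ↔ ¬ c i = s
        · left
          ext w
          have := e w
          simp only [mem_branchName, Set.mem_empty_iff_false]
          clear hF hF' hS hne hsmall hempty hi' d e
          grind
        · right
          ext w
          have := e w
          simp only [mem_branchName, Set.mem_empty_iff_false, Set.mem_compl_iff]
          clear hF hF' hS hne hsmall hempty hi' d e
          grind
      rw [e, branchName_empty]
      exact h.adj _ _

/-! ### All positions of three terminals -/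

/-- A suitable translation of the names relabels the four classes by a translation of the Klein
four-group. -/
theorem part_translate (h : IsFoldedNaming G φ) (c : ι → Fin 4) (k m : Fin 4) :
    φ (part c m ∆ (part c 0 ∆ part c k)) = φ (part c (m ^^^ k)) := by
  have d : ∀ k m : Fin 4, (∀ l, (l = m ↔ (l = 0 ↔ l = k)) ↔ l = m ^^^ k) ∨
      ∀ l, (l = m ↔ (l = 0 ↔ l = k)) ↔ l ≠ m ^^^ k := by decide
  rw [h.eq_iff]
  refine (d k m).imp (fun d => ?_) fun d => ?_ <;>
  · ext w
    have := d (c w)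
    simp only [Set.mem_compl_iff, Set.mem_symmDiff, part, Set.mem_ofPred_eq]
    grind

/-- If there are two classes of one element, `{i}` and `{j}`, relabelling makes them two of the
terminals; the third terminal is then one of the other two classes. -/
theorem hasTrees_of_colouring [Finite ι] [DecidableEq V] (h : IsFoldedNaming G φ) (c : ι → Fin 4)
    (h12 : φ (part c 1) ≠ φ (part c 2)) (h13 : φ (part c 1) ≠ φ (part c 3))
    (h23 : φ (part c 2) ≠ φ (part c 3)) {n : ℕ} (hι : Nat.card ι = n + 1) :
    HasInternallyDisjointTrees G {φ (part c 1), φ (part c 2), φ (part c 3)} n := by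
  -- if two classes were empty, two terminals would be equal
  have hne : ∀ k l, k ≠ l → ∃ w, c w = k ∨ c w = l := by
    intro k l hkl
    have d : ∀ k l : Fin 4, k ≠ l → ∃ t s : Fin 4, t ≠ 0 ∧ s ≠ 0 ∧ t < s ∧
        ((∀ m, m ≠ k → m ≠ l → (m = t ↔ m = s)) ∨ ∀ m, m ≠ k → m ≠ l → (m = t ↔ ¬ m = s)) := by
      decide
    obtain ⟨t, s, ht, hs, hts, d⟩ := d k l hkl
    by_contra! hno
    have e : φ (part c t) = φ (part c s) := by
      rw [h.eq_iff, Set.ext_iff, Set.ext_iff]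
      exact d.imp (fun d w => d _ (hno w).1 (hno w).2) fun d w => d _ (hno w).1 (hno w).2
    have : ∀ t s : Fin 4, t ≠ 0 → s ≠ 0 → t < s →
        (t = 1 ∧ s = 2) ∨ (t = 1 ∧ s = 3) ∨ (t = 2 ∧ s = 3) := by decide
    rcases this t s ht hs hts with ⟨rfl, rfl⟩ | ⟨rfl, rfl⟩ | ⟨rfl, rfl⟩
    exacts [h12 e, h13 e, h23 e]
  by_cases hsmall : ∀ i j, (∀ i', c i' = c i → i' = i) → (∀ j', c j' = c j → j' = j) → i = j
  · exact h.hasTrees_of_parts c hne hsmall hι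
  push Not at hsmall
  obtain ⟨i, j, hi, hj, hij⟩ := hsmall
  have hcij : c i ≠ c j := fun e => hij (hj i e)
  have d : ∀ k₁ k₂ : Fin 4, k₁ ≠ k₂ → ∃ k l, k₁ ≠ l ∧ k₂ ≠ l ∧
      ({k₁ ^^^ k, k₂ ^^^ k, l ^^^ k} : Finset (Fin 4)) = {1, 2, 3} := by decide
  obtain ⟨k, l, h1, h2, hkl⟩ := d _ _ hcij
  have key := (h.translate (part c 0 ∆ part c k)).hasTrees_of_pair hij (B := part c l) h1 h2 hι
  have ei : ({i} : Set ι) = part c (c i) := by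
    ext w
    exact ⟨fun hw => congrArg c hw, hi w⟩
  have ej : ({j} : Set ι) = part c (c j) := by
    ext w
    exact ⟨fun hw => congrArg c hw, hj w⟩
  rw [ei, ej, h.part_translate, h.part_translate, h.part_translate] at key
  have := congrArg (Finset.image fun t => φ (part c t)) hkl
  simp only [Finset.image_insert, Finset.image_singleton] at this
  rwa [this] at key

/-- The three terminals differ from their majority on three disjoint sets. -/
theorem exists_colouring (A₁ A₂ A₃ : Set ι) : ∃ (U : Set ι) (c : ι → Fin 4),
    part c 1 ∆ U = A₁ ∧ part c 2 ∆ U = A₂ ∧ part c 3 ∆ U = A₃ := by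
  classical
  refine ⟨(A₁ ∩ A₂) ∪ (A₁ ∩ A₃) ∪ (A₂ ∩ A₃), fun w =>
    if (w ∈ A₂ ↔ w ∈ A₃) then (if (w ∈ A₁ ↔ w ∈ A₂) then 0 else 1)
    else if (w ∈ A₁ ↔ w ∈ A₃) then 2 else 3, ?_, ?_, ?_⟩ <;>
  · ext w
    by_cases h1 : w ∈ A₁ <;> by_cases h2 : w ∈ A₂ <;> by_cases h3 : w ∈ A₃ <;>
      simp [part, Set.mem_symmDiff, h1, h2, h3]
end IsFoldedNaming

theorem foldedHypercube_hasInternallyDisjointTrees {n : ℕ} (hn : n ≠ 0)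
    (S : Finset (Fin n → Bool)) (hS : S.card = 3) :
    HasInternallyDisjointTrees (foldedHypercube n) S n := by
  obtain ⟨x, y, z, hxy, hxz, hyz, rfl⟩ := Finset.card_eq_three.1 hS
  obtain ⟨A, rfl⟩ : ∃ A, cubeVertex A = x := ⟨_, cubeVertex_image_some x⟩
  obtain ⟨B, rfl⟩ : ∃ A, cubeVertex A = y := ⟨_, cubeVertex_image_some y⟩
  obtain ⟨C, rfl⟩ : ∃ A, cubeVertex A = z := ⟨_, cubeVertex_image_some z⟩
  obtain ⟨U, c, rfl, rfl, rfl⟩ := IsFoldedNaming.exists_colouring A B C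
  exact ((isFoldedNaming_cubeVertex hn).translate U).hasTrees_of_colouring c hxy hxz hyz
    (by simp)

/-- Two adjacent vertices and a third one are joined by at most `n` trees. -/
theorem foldedHypercube_exists_trees_le {n : ℕ} (hn : 2 ≤ n) :
    ∃ S : Finset (Fin n → Bool), S.card = 3 ∧
      ∀ r, HasInternallyDisjointTrees (foldedHypercube n) S r → r ≤ n := by
  have hn0 : n ≠ 0 := by omega
  let o : Fin n := ⟨0, by omega⟩
  let o' : Fin n := ⟨1, by omega⟩
  have ho : o' ≠ o := by simp [o, o']
  let x : Fin n → Bool := fun _ => false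
  let y : Fin n → Bool := Function.update x o true
  let z : Fin n → Bool := fun _ => true
  have hxy : (foldedHypercube n).Adj x y := by
    rw [foldedHypercube_adj_iff hn0]
    refine Or.inl ⟨o, by simp [x, y], fun i hi => ?_⟩
    by_contra hio
    simp [x, y, Function.update_of_ne hio] at hi
  have hzx : z ≠ x := fun e => by simpa [x, z] using congrFun e o
  have hzy : z ≠ y := fun e => by simpa [x, y, z, ho] using congrFun e o'
  refine ⟨{x, y, z}, Finset.card_eq_three.2 ⟨x, y, z, hxy.ne, hzx.symm, hzy.symm, rfl⟩,
    fun r hr => ?_⟩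
  exact Nat.lt_succ_iff.1 (lt_of_hasInternallyDisjointTrees hxy hzx hzy (Set.toFinite _)
    (Set.toFinite _) (ncard_neighborSet_foldedHypercube_le hn0 x)
    (ncard_neighborSet_foldedHypercube_le hn0 y) hr)

theorem theorem1 (n : ℕ) (hn : 2 ≤ n) :
    generalizedConnectivity (foldedHypercube n) 3 = (n : ℕ∞) ∧
      IsGreatest {r : ℕ | ∀ S : Finset (Fin n → Bool), S.card = 3 →
        HasInternallyDisjointTrees (foldedHypercube n) S r} n := by
  have hlow := foldedHypercube_hasInternallyDisjointTrees (n := n) (by omega)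
  obtain ⟨S, hS, hup⟩ := foldedHypercube_exists_trees_le hn
  refine ⟨le_antisymm ?_ ?_, hlow, fun r hr => hup r (hr S hS)⟩
  · exact (iInf₂_le S hS).trans (iSup₂_le fun r hr => by exact_mod_cast hup r hr)
  · exact le_iInf₂ fun S hS => le_iSup₂_of_le n (hlow S hS) le_rfl
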